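/- Let $d\ge 1$, let $\|\cdot\|$ be a norm on $\mathbb{R}^d$ with dual norm $\|x\|_*=\sup\{\langle u,x\rangle:\|u\|\le 1\}$, and put $\Psi_1=\sup_{x\ne0}\|x\|/\|x\|_2$, $\Psi_2=\sup_{x\neq 0}\|x\|_2/\|x\|$. Let $\mathcal X\subset\mathbb{R}^d$ be nonempty, compact and convex, with diameter $D=\sup_{x_1,x_2\in\mathcal X}\|x_1-x_2\|$. Let $P$ be a probability distribution on $\mathbb{R}^d$ that is absolutely continuous with respect to Lebesgue measure, with $\eta=\mathbb{E}_{\sigma\sim P}\|\sigma\|_*<\infty$. Define $\nabla\Phi(g)=\mathbb{E}_{\sigma\sim P}\big[\operatorname{argmin}_{x\in\mathcal X}\langle g-\sigma,x\rangle\big]$ for $g\in\mathbb{R}^d$ (the minimizer is unique for almost every $\sigma$). The predictions are called $\beta$-stable with respect to a norm $\|\cdot\|'$ with dual norm $\|\cdot\|'_*$ if $\|\nabla\Phi(g_1)-\nabla\Phi(g_2)\|'_{*}\le\beta\|g_1-g_2\|'$ for all $g_1,g_2\in\mathbb{R}^d$. Suppose that the predictions are $C\eta^{-1}$-stable with respect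 to $\|\cdot\|_*$ for some constant $C>0$. Convex OFTPL with $m\ge1$ samples runs for $T$ rounds as follows. In round $t=1,\dots,T$, with a guess $g_t$ available, it draws $\sigma_{t,1},\dots,\sigma_{t,m}\sim P$ independently of each other and of everything that happened before, picks $x_{t,j}\in\operatorname{argmin}_{x\in\mathcal X}\langle\nabla_{1:t-1}+g_t-\sigma_{t,j},x\rangle$, where $\nabla_{1:t-1}=\sum_{s<t}\nabla_s$, and plays $x_t=\frac1m\sum_{j=1}^m x_{t,j}$; it then observes the loss $f_t$, and $\nabla_t=\nabla f_t(x_t)$. The losses $f_t$ and the guesses $g_t$ may be random and may depend on all the past, but not on the fresh perturbations $\sigma_{t,1},\dots,\sigma_{t,m}$. Suppose that each $f_t$ is convex and differentiable on $\mathcal X$ and that, for some constants $L$ and $\alpha\in[0,1]$, $\|\nabla f_t(x)-\nabla f_t(x')\|_*\le L\|x-x'\|^\alpha$ for all $x,x'\in\mathcal X$. Suppose also that $\mathbb{E}|f_t(x)|<\infty$ for all $x\in\mathcal X$ and that $\mathbb{E}\|\nabla_t-g_t\|_*^2<\infty$ for every $t$. Then the regret and the squared distances below are integrable and $$\sup_{x\in\mathcal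 X}\mathbb{E}\Big[\sum_{t=1}^T f_t(x_t)-f_t(x)\Big]\le\eta D+\sum_{t=1}^T\frac{C}{2\eta}\mathbb{E}\|\nabla_t-g_t\|_*^2-\sum_{t=1}^T\frac{\eta}{2C}\mathbb{E}\|x_t^\infty-\tilde x_{t-1}^\infty\|^2+LT\Big(\frac{\Psi_1\Psi_2D}{\sqrt m}\Big)^{1+\alpha},$$ where $x_t^\infty=\mathbb{E}[x_t\mid g_t,f_{1:t-1},x_{1:t-1}]$, $\tilde x_{t-1}^\infty=\mathbb{E}[\tilde x_{t-1}\mid f_{1:t-1},x_{1:t-1}]$, and $\tilde x_{t-1}$ is the prediction that the algorithm would make in round $t$ with the guess $g_t=0$. -/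

import Mathlib

open MeasureTheory ProbabilityTheory

namespace OFTPL

/-- The space `ℝ^d`, with its standard inner product and Euclidean norm. -/
abbrev Vec (d : ℕ) : Type := EuclideanSpace ℝ (Fin d)

/-- The dual norm `‖x‖_* = sup {⟨u, x⟩ : ‖u‖ ≤ 1}` of a norm `N = ‖·‖` on `ℝ^d`. -/
noncomputable def dualNorm {d : ℕ} (N : Vec d → ℝ) (x : Vec d) : ℝ :=
  sSup {r : ℝ | ∃ u : Vec d, N u ≤ 1 ∧ r = inner ℝ u x}

/-- First norm compatibility constant `sup_{x ≠ 0} ‖x‖ / ‖x‖₂`. -/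
noncomputable def compatOne {d : ℕ} (N : Vec d → ℝ) : ℝ :=
  sSup {r : ℝ | ∃ x : Vec d, x ≠ 0 ∧ r = N x / ‖x‖}

/-- Second norm compatibility constant `sup_{x ≠ 0} ‖x‖₂ / ‖x‖`. -/
noncomputable def compatTwo {d : ℕ} (N : Vec d → ℝ) : ℝ :=
  sSup {r : ℝ | ∃ x : Vec d, x ≠ 0 ∧ r = ‖x‖ / N x}

/-- Diameter of `X` with respect to the norm `N`. -/
noncomputable def diameter {d : ℕ} (N : Vec d → ℝ) (X : Set (Vec d)) : ℝ :=
  sSup {r : ℝ | ∃ x₁ ∈ X, ∃ x₂ ∈ X, r = N (x₁ - x₂)}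

/-- The set `argmin_{x ∈ X} ⟨v, x⟩`. -/
def linArgmin {d : ℕ} (X : Set (Vec d)) (v : Vec d) : Set (Vec d) :=
  {y | y ∈ X ∧ ∀ z ∈ X, inner ℝ v y ≤ inner ℝ v z}

/-- Some element of `argmin_{x ∈ X} ⟨v, x⟩` (for compact nonempty `X` the argmin is nonempty,
and it is a single point for Lebesgue almost every `v`). -/
noncomputable def argminPoint {d : ℕ} (X : Set (Vec d)) (v : Vec d) : Vec d :=
  Classical.epsilon fun y => y ∈ linArgmin X v

/-- `∇Φ(g) = E_σ [argmin_{x ∈ X} ⟨g - σ, x⟩]`, with `σ` distributed according to `P`: the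
prediction of the deterministic version of the algorithm. -/
noncomputable def gradPhi {d : ℕ} (X : Set (Vec d)) (P : Measure (Vec d)) (g : Vec d) : Vec d :=
  ∫ s, argminPoint X (g - s) ∂P

/-- `β`-stability of the predictions with respect to a norm `M`:
`‖∇Φ(g₁) - ∇Φ(g₂)‖_{M,*} ≤ β ‖g₁ - g₂‖_M`. -/
def IsStable {d : ℕ} (X : Set (Vec d)) (P : Measure (Vec d)) (M : Vec d → ℝ) (β : ℝ) : Prop :=
  ∀ g₁ g₂ : Vec d, dualNorm M (gradPhi X P g₁ - gradPhi X P g₂) ≤ β * M (g₁ - g₂)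

section Run

variable {d m : ℕ} {Ω : Type*}

/-- The average `m⁻¹ ∑_j x_j` of the `m` minimizers computed in a round. -/
noncomputable def average (x : Fin m → Ω → Vec d) (ω : Ω) : Vec d :=
  (m : ℝ)⁻¹ • ∑ j, x j ω

/-- `∇_t = ∇f_t(x_t)`, where `x_t` is the average of the `x_{t,j}`. -/
noncomputable def playedGrad (gradf : ℕ → Ω → Vec d → Vec d) (x : ℕ → Fin m → Ω → Vec d)
    (t : ℕ) (ω : Ω) : Vec d :=
  gradf t ω (average (x t) ω)

/-- The sum of the gradients `∇_s` over the rounds `s` before round `t`.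
Rounds are numbered `0, 1, …, T - 1`. -/
noncomputable def pastGradSum (gradf : ℕ → Ω → Vec d → Vec d) (x : ℕ → Fin m → Ω → Vec d)
    (t : ℕ) (ω : Ω) : Vec d :=
  ∑ s ∈ Finset.range t, playedGrad gradf x s ω

/-- The σ-algebra generated by the losses and the predictions of the rounds before round `t`.
A loss is recorded through its values and its gradients on `X`; the gradient `∇_s`, a function
of the loss and the prediction of round `s`, is listed as well. -/
noncomputable abbrev pastInfo (X : Set (Vec d)) (f : ℕ → Ω → Vec d → ℝ) (gradf : ℕ → Ω → Vec d → Vec d)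
    (x : ℕ → Fin m → Ω → Vec d) (t : ℕ) : MeasurableSpace Ω :=
  ⨆ s : Fin t,
    ((⨆ y : X, MeasurableSpace.comap (fun ω => f s ω y) inferInstance) ⊔
      (⨆ y : X, MeasurableSpace.comap (fun ω => gradf s ω y) inferInstance)) ⊔
    (MeasurableSpace.comap (average (x s)) inferInstance ⊔
      MeasurableSpace.comap (playedGrad gradf x s) inferInstance)

/-- A run of the convex OFTPL algorithm for `T` rounds with `m` samples per round, against a
possibly randomized and adaptive adversary. `f t` is the loss of round `t`, with gradient field
`gradf t`; `g t` is the guess, `σ t j` are the sampled perturbations and `x t j` the minimizers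
computed from them. `ℱ t` is the information present when the perturbations of round `t` are
drawn: it contains all earlier perturbations and predictions, the guess `g t`, and the loss `f t`
(which is chosen simultaneously with the prediction, hence without knowledge of the fresh
perturbations). -/
structure IsRun [mΩ : MeasurableSpace Ω] (μ : Measure Ω) (ℱ : Filtration ℕ mΩ)
    (X : Set (Vec d)) (P : Measure (Vec d)) (T : ℕ)
    (f : ℕ → Ω → Vec d → ℝ) (gradf : ℕ → Ω → Vec d → Vec d) (g : ℕ → Ω → Vec d)
    (σ x : ℕ → Fin m → Ω → Vec d) : Prop where
  measurable_loss : ∀ t < T, ∀ y ∈ X, Measurable[ℱ t] (fun ω => f t ω y)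
  measurable_grad : ∀ t < T,
    Measurable[(ℱ t).prod inferInstance] (fun p : Ω × X => gradf t p.1 p.2)
  measurable_guess : ∀ t < T, Measurable[ℱ t] (g t)
  measurable_pert : ∀ t < T, ∀ j, Measurable[ℱ (t + 1)] (σ t j)
  measurable_pred : ∀ t < T, ∀ j, Measurable[ℱ (t + 1)] (x t j)
  /-- each perturbation is drawn from `P` -/
  law_pert : ∀ t < T, ∀ j, μ.map (σ t j) = P
  /-- the `m` perturbations of a round are independent -/
  indep_pert : ∀ t < T, iIndepFun (σ t) μ
  /-- and jointly independent of what happened before they are drawn -/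
  indep_past : ∀ t < T, Indep (⨆ j, MeasurableSpace.comap (σ t j) inferInstance) (ℱ t) μ
  pred_mem : ∀ t < T, ∀ j ω, x t j ω ∈ linArgmin X (pastGradSum gradf x t ω + g t ω - σ t j ω)

/-- The deterministic prediction: conditional expectation of the prediction of round `t` given
the guess of round `t` and the losses and predictions of the rounds before. -/
noncomputable def condPred [MeasurableSpace Ω] (μ : Measure Ω) (X : Set (Vec d))
    (f : ℕ → Ω → Vec d → ℝ) (gradf : ℕ → Ω → Vec d → Vec d) (g : ℕ → Ω → Vec d)
    (x : ℕ → Fin m → Ω → Vec d) (t : ℕ) : Ω → Vec d :=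
  μ[average (x t) | MeasurableSpace.comap (g t) inferInstance ⊔ pastInfo X f gradf x t]

/-- Conditional expectation, given the losses and predictions of the rounds before round `t`, of
the average of the minimizers `xz t j` that round `t` would produce with guess `0`. -/
noncomputable def condPredZero [MeasurableSpace Ω] (μ : Measure Ω) (X : Set (Vec d))
    (f : ℕ → Ω → Vec d → ℝ) (gradf : ℕ → Ω → Vec d → Vec d)
    (x xz : ℕ → Fin m → Ω → Vec d) (t : ℕ) : Ω → Vec d :=
  μ[average (xz t) | pastInfo X f gradf x t]

end Run

end OFTPL

/-!
The proof compares the algorithm with its deterministic counterpart, which plays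
`a_t = ∇Φ(G_t + g_t)`, where `G_t` is the sum of the gradients observed before round `t`. By
convexity of the losses, the regret is at most
`∑ ⟨∇_t, a_t - y⟩ + ∑ ⟨∇_t, x_t - a_t⟩`, and the two sums are treated separately.

*Deterministic part.* The potential `Φ(g) = E_σ [min_{x ∈ X} ⟨g - σ, x⟩]` is concave, and `∇Φ` is a
supergradient map of it (`potential_le_add_inner`). Stability says that this map is Lipschitz from
the dual norm to the norm, so `Φ` is smooth. Smoothness gives the descent inequality
(`descent_inequality`) and co-coercivity (`cocoercive`); applied around the point `G_t + g_t` they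
bound `⟨∇_t, a_t⟩` by the increment of `Φ` along `∇_t`, plus the error of the guess, minus the
squared distance of `a_t` to `∇Φ(G_t)` (`optimistic_step`). The increments telescope, and
`Φ(G) - Φ(0)` exceeds `⟨G, y⟩` by at most `E‖σ‖_*` times the diameter (`potential_sub_le`). The sum of
these bounds, `sum_inner_gradPhi_sub_le`, holds for every outcome. No differentiability of `Φ` is
needed.

*Sampling part.* The optimal value `v ↦ min_{x ∈ X} ⟨v, x⟩` is Lipschitz, so by Rademacher's theorem
it is differentiable almost everywhere, and where it is, its gradient is the only minimizer
(`eq_minGrad`). As the law of the perturbations is absolutely continuous, a minimizer is almost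
surely a Borel function of the past and the fresh perturbation
(`IsFreshDraw.ae_eq_minGrad`). Independence then yields that `a_t` is the conditional
expectation of `x_t` (`IsFreshDraw.condExp_average`), that the deviations `x_{t,j} - a_t` are
orthogonal to the past and to each other, and that the variance of `x_t` is of order `1 / m`
(`IsFreshDraw.integral_norm_sq_le`). In `E⟨∇f_t(x_t), x_t - a_t⟩` one may therefore subtract the
gradient at `a_t` for free; the Hölder condition and Jensen's inequality bound the rest
(`IsFreshDraw.integral_inner_gradient_le`).

*Integrability.* The gradients themselves need not be integrable: when `X` has empty interior, their
component normal to `X` is arbitrary. Only pairings with directions of `X` occur, and these are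
dominated by the values of the loss at finitely many points (`exists_integrable_envelope`).
-/

namespace OFTPL

/-! ### Norms on `ℝ^d` and their duals -/

section Norms

variable {d : ℕ} (N : Seminorm ℝ (Vec d))

theorem exists_seminorm_le_mul_norm : ∃ K > 0, ∀ v : Vec d, N v ≤ K * ‖v‖ := by
  have hc : Continuous N :=
    continuousOn_univ.mp (N.convexOn.continuousOn isOpen_univ)
  exact N.bound_of_continuous_normedSpace hc

variable {N} (hN : ∀ v, N v = 0 → v = 0)
include hN

theorem exists_norm_le_mul_seminorm : ∃ K > 0, ∀ v : Vec d, ‖v‖ ≤ K * N v := by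
  have hc : Continuous N :=
    continuousOn_univ.mp (N.convexOn.continuousOn isOpen_univ)
  have hpos : ∀ v : Vec d, v ≠ 0 → 0 < N v := fun v hv =>
    lt_of_le_of_ne (apply_nonneg N v) fun h => hv (hN v h.symm)
  obtain ⟨c, hc0, hcb⟩ : ∃ c > 0, ∀ v ∈ Metric.sphere (0 : Vec d) 1, c ≤ N v := by
    rcases (Metric.sphere (0 : Vec d) 1).eq_empty_or_nonempty with he | hne
    · exact ⟨1, one_pos, by simp [he]⟩
    · obtain ⟨v, hv, hmin⟩ := (isCompact_sphere (0 : Vec d) 1).exists_isMinOn hne hc.continuousOn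
      refine ⟨N v, hpos v ?_, fun w hw => hmin hw⟩
      rintro rfl
      simp at hv
  refine ⟨c⁻¹, inv_pos.mpr hc0, fun v => ?_⟩
  rcases eq_or_ne v 0 with rfl | hv
  · simp
  have h1 := hcb (‖v‖⁻¹ • v) (by simp [norm_smul, hv])
  have hv' : 0 < ‖v‖ := norm_pos_iff.mpr hv
  rw [map_smul_eq_mul, norm_inv, norm_norm, ← div_eq_inv_mul, le_div_iff₀ hv'] at h1
  rw [← div_eq_inv_mul, le_div_iff₀ hc0]
  linarith

theorem bddAbove_dualNorm (x : Vec d) :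
    BddAbove {r : ℝ | ∃ u : Vec d, N u ≤ 1 ∧ r = inner ℝ u x} := by
  obtain ⟨K, hK, hb⟩ := exists_norm_le_mul_seminorm hN
  refine ⟨K * ‖x‖, ?_⟩
  rintro _ ⟨u, hu, rfl⟩
  calc inner ℝ u x ≤ ‖u‖ * ‖x‖ := real_inner_le_norm u x
    _ ≤ K * ‖x‖ := by
      gcongr
      exact (hb u).trans (mul_le_of_le_one_right hK.le hu)

theorem inner_le_dualNorm_of_le_one {u : Vec d} (hu : N u ≤ 1) (x : Vec d) :
    inner ℝ u x ≤ dualNorm N x :=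
  le_csSup (bddAbove_dualNorm hN x) ⟨u, hu, rfl⟩

theorem dualNorm_nonneg (x : Vec d) : 0 ≤ dualNorm N x := by
  simpa using inner_le_dualNorm_of_le_one hN (u := 0) (by simp) x

theorem inner_le_mul_dualNorm (u x : Vec d) : inner ℝ u x ≤ N u * dualNorm N x := by
  rcases eq_or_ne (N u) 0 with h | h
  · simp [hN u h]
  have hu : 0 < N u := lt_of_le_of_ne (apply_nonneg N u) h.symm
  have h1 := inner_le_dualNorm_of_le_one hN (u := (N u)⁻¹ • u)
    (by rw [map_smul_eq_mul, norm_inv, Real.norm_of_nonneg hu.le, inv_mul_cancel₀ h]) x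
  rwa [real_inner_smul_left, ← div_eq_inv_mul, div_le_iff₀ hu, mul_comm] at h1

omit hN in
theorem dualNorm_le {x : Vec d} {c : ℝ} (h : ∀ u, N u ≤ 1 → inner ℝ u x ≤ c) :
    dualNorm N x ≤ c :=
  csSup_le ⟨_, 0, by simp, rfl⟩ (by rintro _ ⟨u, hu, rfl⟩; exact h u hu)

/-- The dual norm, bundled as a seminorm. -/
noncomputable def dualSeminorm : Seminorm ℝ (Vec d) :=
  Seminorm.of (dualNorm N)
    (fun x y => dualNorm_le fun u hu => by
      rw [inner_add_right]
      exact add_le_add (inner_le_dualNorm_of_le_one hN hu x) (inner_le_dualNorm_of_le_one hN hu y))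
    (by
      have key : ∀ (a : ℝ) (x : Vec d), dualNorm N (a • x) ≤ ‖a‖ * dualNorm N x := by
        refine fun a x => dualNorm_le fun u hu => ?_
        rw [inner_smul_right, ← real_inner_smul_left]
        refine (inner_le_mul_dualNorm hN (a • u) x).trans ?_
        have := dualNorm_nonneg hN x
        rw [map_smul_eq_mul]
        gcongr
        exact mul_le_of_le_one_right (norm_nonneg a) hu
      intro a x
      refine le_antisymm (key a x) ?_
      rcases eq_or_ne a 0 with rfl | ha
      · simpa using dualNorm_nonneg hN _
      have h := key a⁻¹ (a • x)
      rw [smul_smul, inv_mul_cancel₀ ha, one_smul, norm_inv, ← div_eq_inv_mul,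
        le_div_iff₀ (norm_pos_iff.mpr ha)] at h
      linarith)

theorem dualSeminorm_apply (x : Vec d) : dualSeminorm hN x = dualNorm N x := rfl

theorem dualSeminorm_eq_zero (x : Vec d) (h : dualSeminorm hN x = 0) : x = 0 := by
  have h1 := inner_le_mul_dualNorm hN x x
  rw [← dualSeminorm_apply hN, h, mul_zero] at h1
  rw [real_inner_self_eq_norm_sq] at h1
  exact norm_eq_zero.mp (pow_eq_zero_iff two_ne_zero |>.mp (le_antisymm h1 (sq_nonneg _)))

omit hN in
/-- Hahn–Banach: every vector is normed by some functional of dual norm at most one. -/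
theorem exists_dualNorm_le_one_inner_eq (v : Vec d) :
    ∃ u : Vec d, dualNorm N u ≤ 1 ∧ inner ℝ u v = N v := by
  rcases eq_or_ne v 0 with rfl | hv
  · exact ⟨0, dualNorm_le fun u _ => by simp, by simp⟩
  obtain ⟨φ, hφ, hle⟩ := exists_extension_of_le_sublinear
    (LinearPMap.mkSpanSingleton (K := ℝ) v (N v) hv) N
    (fun c hc x => by rw [map_smul_eq_mul, Real.norm_of_nonneg hc.le])
    (map_add_le_add N) (by
      rintro ⟨x, hx⟩
      obtain ⟨c, rfl⟩ := Submodule.mem_span_singleton.mp hx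
      rw [LinearPMap.mkSpanSingleton'_apply, map_smul_eq_mul, smul_eq_mul]
      gcongr
      exact le_abs_self c)
  set u := (InnerProductSpace.toDual ℝ (Vec d)).symm (LinearMap.toContinuousLinearMap φ) with hu
  have hin : ∀ w, inner ℝ u w = φ w := fun w => by simp [hu]
  refine ⟨u, dualNorm_le fun w hw => ?_, ?_⟩
  · rw [real_inner_comm, hin]
    exact (hle w).trans hw
  · have h1 := hφ ⟨v, Submodule.mem_span_singleton_self v⟩
    rw [hin]
    exact h1.trans (LinearPMap.mkSpanSingleton_apply ℝ ℝ hv (N v))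

/-- The bidual norm dominates the norm. -/
theorem le_dualNorm_dualNorm (v : Vec d) : N v ≤ dualNorm (dualNorm N) v := by
  obtain ⟨u, hu, huv⟩ := exists_dualNorm_le_one_inner_eq (N := N) v
  rw [← huv]
  exact inner_le_dualNorm_of_le_one (dualSeminorm_eq_zero hN) (u := u) hu v

theorem compatTwo_bound (v : Vec d) : ‖v‖ ≤ compatTwo N * N v := by
  rcases eq_or_ne v 0 with rfl | hv
  · simp
  obtain ⟨K, hK, hb⟩ := exists_norm_le_mul_seminorm hN
  have hpos : ∀ w : Vec d, w ≠ 0 → 0 < N w := fun w hw =>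
    lt_of_le_of_ne (apply_nonneg N w) fun h => hw (hN w h.symm)
  rw [← div_le_iff₀ (hpos v hv)]
  refine le_csSup ⟨K, ?_⟩ ⟨v, hv, rfl⟩
  rintro _ ⟨w, hw, rfl⟩
  rw [div_le_iff₀ (hpos w hw)]
  exact hb w

omit hN in
theorem compatOne_bound (v : Vec d) : N v ≤ compatOne N * ‖v‖ := by
  rcases eq_or_ne v 0 with rfl | hv
  · simp
  obtain ⟨K, hK, hb⟩ := exists_seminorm_le_mul_norm N
  rw [← div_le_iff₀ (norm_pos_iff.mpr hv)]
  refine le_csSup ⟨K, ?_⟩ ⟨v, hv, rfl⟩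
  rintro _ ⟨w, hw, rfl⟩
  rw [div_le_iff₀ (norm_pos_iff.mpr hw)]
  exact hb w

omit hN in
theorem compatOne_nonneg : 0 ≤ compatOne N :=
  Real.sSup_nonneg (by rintro _ ⟨x, -, rfl⟩; exact div_nonneg (apply_nonneg N x) (norm_nonneg x))

omit hN in
theorem compatTwo_nonneg : 0 ≤ compatTwo N :=
  Real.sSup_nonneg (by rintro _ ⟨x, -, rfl⟩; exact div_nonneg (norm_nonneg x) (apply_nonneg N x))

omit hN in
theorem diameter_nonneg (X : Set (Vec d)) : 0 ≤ diameter N X :=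
  Real.sSup_nonneg (by rintro _ ⟨x, -, y, -, rfl⟩; exact apply_nonneg N _)

omit hN in
theorem diameter_eq_zero_of_subsingleton {X : Set (Vec d)} (hX : X.Subsingleton) :
    diameter N X = 0 := by
  refine le_antisymm (Real.sSup_nonpos ?_) (diameter_nonneg X)
  rintro _ ⟨x, hx, y, hy, rfl⟩
  simp [hX hx hy]

omit hN in
theorem le_diameter {X : Set (Vec d)} (hX : IsCompact X) {x y : Vec d} (hx : x ∈ X) (hy : y ∈ X) :
    N (x - y) ≤ diameter N X := by
  obtain ⟨K, hK, hb⟩ := exists_seminorm_le_mul_norm N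
  obtain ⟨R, hR⟩ := hX.isBounded.exists_norm_le
  refine le_csSup ⟨K * (R + R), ?_⟩ ⟨x, hx, y, hy, rfl⟩
  rintro _ ⟨a, ha, b, hb', rfl⟩
  refine (hb _).trans ?_
  gcongr
  exact (norm_sub_le a b).trans (add_le_add (hR a ha) (hR b hb'))

omit hN in
theorem measurable_seminorm : Measurable N :=
  (continuousOn_univ.mp (N.convexOn.continuousOn isOpen_univ)).measurable

end Norms

/-! ### Linear minimization over a compact convex set -/

section Linear

variable {d : ℕ} {X : Set (Vec d)}

/-- The optimal value `min_{x ∈ X} ⟨v, x⟩`. -/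
noncomputable def minVal (X : Set (Vec d)) (v : Vec d) : ℝ := inner ℝ v (argminPoint X v)

/-- A Borel measurable version of `argminPoint`: the gradient of the optimal value. -/
noncomputable def minGrad (X : Set (Vec d)) (v : Vec d) : Vec d := gradient (minVal X) v

theorem argminPoint_mem_linArgmin (hX : IsCompact X) (hne : X.Nonempty) (v : Vec d) :
    argminPoint X v ∈ linArgmin X v := by
  obtain ⟨y, hy, hmin⟩ := hX.exists_isMinOn hne
    (f := fun x => inner ℝ v x) (by fun_prop)
  exact Classical.epsilon_spec (p := fun y => y ∈ linArgmin X v) ⟨y, hy, fun z hz => hmin hz⟩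

theorem argminPoint_mem (hX : IsCompact X) (hne : X.Nonempty) (v : Vec d) :
    argminPoint X v ∈ X := (argminPoint_mem_linArgmin hX hne v).1

theorem minVal_le (hX : IsCompact X) {y : Vec d} (hy : y ∈ X) (v : Vec d) :
    minVal X v ≤ inner ℝ v y := (argminPoint_mem_linArgmin hX ⟨y, hy⟩ v).2 y hy

theorem minVal_eq (hX : IsCompact X) {v y : Vec d} (hy : y ∈ linArgmin X v) :
    minVal X v = inner ℝ v y :=
  le_antisymm (minVal_le hX hy.1 v) (hy.2 _ (argminPoint_mem hX ⟨y, hy.1⟩ v))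

/-- Minimizers are supergradients of the optimal value. -/
theorem minVal_le_add_inner (hX : IsCompact X) {v y : Vec d} (hy : y ∈ linArgmin X v)
    (w : Vec d) : minVal X w ≤ minVal X v + inner ℝ (w - v) y := by
  rw [minVal_eq hX hy, ← inner_add_left, add_sub_cancel]
  exact minVal_le hX hy.1 w

theorem exists_lipschitzWith_minVal (hX : IsCompact X) (hne : X.Nonempty) :
    ∃ R, LipschitzWith R (minVal X) := by
  obtain ⟨R, hR0, hR⟩ := hX.isBounded.exists_pos_norm_le
  refine ⟨⟨R, hR0.le⟩, LipschitzWith.of_le_add_mul _ fun v w => ?_⟩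
  have ha := argminPoint_mem_linArgmin hX hne w
  refine (minVal_le_add_inner hX ha v).trans ?_
  gcongr
  rw [dist_eq_norm]
  refine (real_inner_le_norm _ _).trans ?_
  rw [mul_comm]
  gcongr
  exact hR _ ha.1

/-- Where the optimal value is differentiable, the minimizer is unique: it is the gradient. -/
theorem eq_minGrad (hX : IsCompact X) {v y : Vec d} (hv : DifferentiableAt ℝ (minVal X) v)
    (hy : y ∈ linArgmin X v) : y = minGrad X v := by
  -- the gap in the supergradient inequality is nonnegative and vanishes at `v`
  have hd : HasFDerivAt (fun w => minVal X v + inner ℝ (w - v) y - minVal X w)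
      (innerSL ℝ y - fderiv ℝ (minVal X) v) v := by
    have h1 : HasFDerivAt (fun w : Vec d => minVal X v + inner ℝ (w - v) y) (innerSL ℝ y) v := by
      have h2 := (innerSL ℝ y).hasFDerivAt (x := v)
      have h3 : (fun w : Vec d => minVal X v + inner ℝ (w - v) y)
          = fun w => innerSL ℝ y w + (minVal X v - inner ℝ v y) := by
        funext w
        rw [inner_sub_left, innerSL_apply_apply, real_inner_comm w y]
        ring
      rw [h3]
      exact h2.add_const _
    exact h1.sub hv.hasFDerivAt
  have hmin : IsLocalMin (fun w => minVal X v + inner ℝ (w - v) y - minVal X w) v :=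
    Filter.Eventually.of_forall fun w => by
      have := minVal_le_add_inner hX hy w
      simp only [sub_self, inner_zero_left]
      linarith
  have h0 := sub_eq_zero.mp (hmin.hasFDerivAt_eq_zero hd)
  rw [minGrad, gradient, ← h0]
  exact ((InnerProductSpace.toDual ℝ (Vec d)).symm_apply_apply y).symm

theorem measurable_minGrad : Measurable (minGrad X) :=
  (InnerProductSpace.toDual ℝ (Vec d)).symm.continuous.measurable.comp (measurable_fderiv ℝ _)

theorem ae_differentiableAt_minVal (hX : IsCompact X) (hne : X.Nonempty) :
    ∀ᵐ v : Vec d, DifferentiableAt ℝ (minVal X) v := by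
  obtain ⟨R, hR⟩ := exists_lipschitzWith_minVal hX hne
  exact hR.ae_differentiableAt

variable {P : Measure (Vec d)}

theorem ae_differentiableAt_minVal_sub (hP : P ≪ volume) (hX : IsCompact X) (hne : X.Nonempty)
    (g : Vec d) : ∀ᵐ s ∂P, DifferentiableAt ℝ (minVal X) (g - s) :=
  hP.ae_le ((Measure.measurePreserving_sub_left volume g).quasiMeasurePreserving.ae
    (ae_differentiableAt_minVal hX hne))

theorem argminPoint_ae_eq_minGrad (hP : P ≪ volume) (hX : IsCompact X) (hne : X.Nonempty)
    (g : Vec d) : (fun s => argminPoint X (g - s)) =ᵐ[P] fun s => minGrad X (g - s) := by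
  filter_upwards [ae_differentiableAt_minVal_sub hP hX hne g] with s hs
  exact eq_minGrad hX hs (argminPoint_mem_linArgmin hX hne _)

theorem minGrad_ae_mem (hP : P ≪ volume) (hX : IsCompact X) (hne : X.Nonempty)
    (g : Vec d) : ∀ᵐ s ∂P, minGrad X (g - s) ∈ X := by
  filter_upwards [argminPoint_ae_eq_minGrad hP hX hne g] with s hs
  rw [← hs]
  exact argminPoint_mem hX hne _

theorem gradPhi_eq (hP : P ≪ volume) (hX : IsCompact X) (hne : X.Nonempty) (g : Vec d) :
    gradPhi X P g = ∫ s, minGrad X (g - s) ∂P :=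
  integral_congr_ae (argminPoint_ae_eq_minGrad hP hX hne g)

variable [IsProbabilityMeasure P]

theorem integrable_minGrad (hP : P ≪ volume) (hX : IsCompact X) (hne : X.Nonempty) (g : Vec d) :
    Integrable (fun s => minGrad X (g - s)) P := by
  obtain ⟨R, hR⟩ := hX.isBounded.exists_norm_le
  refine Integrable.of_bound
    (measurable_minGrad.comp (measurable_const.sub measurable_id)).aestronglyMeasurable R ?_
  filter_upwards [minGrad_ae_mem hP hX hne g] with s hs using hR _ hs

theorem integrable_argminPoint (hP : P ≪ volume) (hX : IsCompact X) (hne : X.Nonempty)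
    (g : Vec d) : Integrable (fun s => argminPoint X (g - s)) P :=
  (integrable_minGrad hP hX hne g).congr (argminPoint_ae_eq_minGrad hP hX hne g).symm

theorem gradPhi_mem (hP : P ≪ volume) (hX : IsCompact X) (hXc : Convex ℝ X) (hne : X.Nonempty)
    (g : Vec d) : gradPhi X P g ∈ X :=
  hXc.integral_mem hX.isClosed (Filter.Eventually.of_forall fun _ => argminPoint_mem hX hne _)
    (integrable_argminPoint hP hX hne g)

/-! ### The smoothed potential -/

/-- The potential `Φ(g) = E_σ [min_{x ∈ X} ⟨g - σ, x⟩]`. -/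
noncomputable def potential (X : Set (Vec d)) (P : Measure (Vec d)) (g : Vec d) : ℝ :=
  ∫ s, minVal X (g - s) ∂P

theorem integrable_minVal (hX : IsCompact X) (hne : X.Nonempty)
    (hs : Integrable (fun s : Vec d => s) P) (g : Vec d) :
    Integrable (fun s => minVal X (g - s)) P := by
  obtain ⟨R, hR⟩ := exists_lipschitzWith_minVal hX hne
  have hint : Integrable (fun s => |minVal X g| + R * ‖s‖) P :=
    (integrable_const _).add (hs.norm.const_mul _)
  refine hint.mono' (hR.continuous.comp (by fun_prop)).aestronglyMeasurable
    (Filter.Eventually.of_forall fun s => ?_)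
  have h1 := hR.dist_le_mul (g - s) g
  rw [Real.dist_eq, dist_eq_norm, sub_sub_cancel_left, norm_neg] at h1
  rw [Real.norm_eq_abs]
  linarith [abs_sub_abs_le_abs_sub (minVal X (g - s)) (minVal X g)]

/-- The potential is concave with supergradient `∇Φ`. -/
theorem potential_le_add_inner (hP : P ≪ volume) (hX : IsCompact X) (hne : X.Nonempty)
    (hs : Integrable (fun s : Vec d => s) P) (g g' : Vec d) :
    potential X P g' ≤ potential X P g + inner ℝ (gradPhi X P g) (g' - g) := by
  have hi := integrable_argminPoint (P := P) hP hX hne g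
  rw [real_inner_comm, gradPhi, ← integral_inner hi, potential, potential,
    ← integral_add (integrable_minVal hX hne hs g) (hi.const_inner _)]
  refine integral_mono (integrable_minVal hX hne hs g')
    ((integrable_minVal hX hne hs g).add (hi.const_inner _)) fun s => ?_
  simpa using minVal_le_add_inner hX (argminPoint_mem_linArgmin hX hne (g - s)) (g' - s)

/-- Perturbing the linear objective costs at most `E‖σ‖_*` times the diameter. -/
theorem potential_sub_le {N : Seminorm ℝ (Vec d)} (hN : ∀ v, N v = 0 → v = 0)
    (hX : IsCompact X)
    (hs : Integrable (fun s : Vec d => s) P) (hPint : Integrable (fun s => dualNorm N s) P)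
    (g : Vec d) {y : Vec d} (hy : y ∈ X) :
    potential X P g - potential X P 0 ≤
      inner ℝ g y + (∫ s, dualNorm N s ∂P) * diameter N X := by
  have hne : X.Nonempty := ⟨y, hy⟩
  have h1 := integrable_minVal (P := P) hX hne hs
  have hrhs : inner ℝ g y + (∫ s, dualNorm N s ∂P) * diameter N X
      = ∫ s, (inner ℝ g y + dualNorm N s * diameter N X) ∂P := by
    rw [integral_add (integrable_const _) (hPint.mul_const _), integral_mul_const]
    simp
  rw [potential, potential, ← integral_sub (h1 g) (h1 0), hrhs]
  refine integral_mono ((h1 g).sub (h1 0)) ((integrable_const _).add (hPint.mul_const _))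
    fun s => ?_
  have h2 := minVal_le hX hy (g - s)
  have h3 : minVal X (0 - s) = inner ℝ (0 - s) (argminPoint X (0 - s)) := rfl
  have ha := argminPoint_mem hX hne (0 - s)
  have h4 := inner_le_mul_dualNorm hN (argminPoint X (0 - s) - y) s
  have h5 : N (argminPoint X (0 - s) - y) * dualNorm N s ≤ dualNorm N s * diameter N X := by
    rw [mul_comm]
    exact mul_le_mul_of_nonneg_left (le_diameter hX ha hy) (dualNorm_nonneg hN s)
  rw [inner_sub_left, real_inner_comm s, real_inner_comm s] at h4
  rw [inner_sub_left] at h2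
  rw [zero_sub, inner_neg_left] at h3
  simp only [zero_sub] at *
  linarith

end Linear

/-! ### Smooth concave functions -/

section Smooth

variable {d : ℕ} {N : Seminorm ℝ (Vec d)} (hN : ∀ v, N v = 0 → v = 0)
  {Φ : Vec d → ℝ} {p : Vec d → Vec d} {β : ℝ}
  (hsup : ∀ a b, Φ b ≤ Φ a + inner ℝ (p a) (b - a))
  (hlip : ∀ a b, N (p a - p b) ≤ β * dualNorm N (a - b))
include hN hsup hlip

/-- A concave function whose supergradient map is Lipschitz obeys the descent inequality. The proof
sums the supergradient inequality over a subdivision of the segment and refines it. -/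
theorem descent_inequality (b c : Vec d) :
    Φ b + inner ℝ (p b) (c - b) - β / 2 * dualNorm N (c - b) ^ 2 ≤ Φ c := by
  set v := c - b with hv
  set M := dualNorm N v with hM
  have hM0 : 0 ≤ M := dualNorm_nonneg hN v
  have hscale : ∀ r : ℝ, 0 ≤ r → dualNorm N (r • v) = r * M := fun r hr => by
    rw [← dualSeminorm_apply hN, map_smul_eq_mul, Real.norm_of_nonneg hr, dualSeminorm_apply]
  have hstep : ∀ r δ : ℝ, 0 ≤ r → 0 ≤ δ →
      Φ (b + r • v) + δ * inner ℝ (p b) v - δ * (r + δ) * (β * M ^ 2)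
        ≤ Φ (b + (r + δ) • v) := fun r δ hr hδ => by
    have h1 := hsup (b + (r + δ) • v) (b + r • v)
    have h2 : b + r • v - (b + (r + δ) • v) = (-δ) • v := by module
    rw [h2, inner_smul_right] at h1
    have h3 := inner_le_mul_dualNorm hN (p b - p (b + (r + δ) • v)) v
    have h4 := hlip b (b + (r + δ) • v)
    rw [← dualSeminorm_apply hN, map_sub_rev (dualSeminorm hN), add_sub_cancel_left,
      dualSeminorm_apply, hscale _ (add_nonneg hr hδ)] at h4
    have h5 := mul_le_mul_of_nonneg_right h4 hM0
    rw [inner_sub_left] at h3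
    have h6 := mul_le_mul_of_nonneg_left (h3.trans h5) hδ
    nlinarith [h6, h1]
  -- the errors `δ * (i + 1) δ` of the single steps add up to `k (k + 1) / 2 * δ ^ 2`
  have hsum : ∀ δ : ℝ, 0 ≤ δ → ∀ k : ℕ,
      Φ b + k * δ * inner ℝ (p b) v - (k * (k + 1) / 2) * δ ^ 2 * (β * M ^ 2)
        ≤ Φ (b + (k * δ) • v) := fun δ hδ k => by
    induction k with
    | zero => simp
    | succ k ih =>
      have h := hstep (k * δ) δ (by positivity) hδ
      have h' : ((k + 1 : ℕ) : ℝ) * δ = k * δ + δ := by push_cast; ring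
      rw [h']
      push_cast
      nlinarith [h, ih]
  have hlim : Filter.Tendsto
      (fun n : ℕ => Φ b + inner ℝ (p b) v - (1 + 1 / ((n : ℝ) + 1)) * (β / 2 * M ^ 2))
      Filter.atTop (nhds (Φ b + inner ℝ (p b) v - (1 + 0) * (β / 2 * M ^ 2))) :=
    tendsto_const_nhds.sub
      ((tendsto_const_nhds.add tendsto_one_div_add_atTop_nhds_zero_nat).mul_const _)
  rw [add_zero, one_mul] at hlim
  refine le_of_tendsto hlim (Filter.Eventually.of_forall fun n => ?_)
  have hn : (0 : ℝ) < n + 1 := by positivity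
  have h := hsum (1 / ((n : ℝ) + 1)) (by positivity) (n + 1)
  have h1 : ((n + 1 : ℕ) : ℝ) * (1 / ((n : ℝ) + 1)) = 1 := by
    push_cast
    field_simp
  rw [h1, one_smul, one_mul, hv, add_sub_cancel, ← hv] at h
  have h2 : (((n + 1 : ℕ) : ℝ) * (((n + 1 : ℕ) : ℝ) + 1) / 2) * (1 / ((n : ℝ) + 1)) ^ 2 *
      (β * M ^ 2) = (1 + 1 / ((n : ℝ) + 1)) * (β / 2 * M ^ 2) := by
    push_cast
    field_simp
  rwa [h2] at h

/-- Co-coercivity: a smooth concave function lies below its supporting planes by at least a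
quadratic in the difference of supergradients. -/
theorem cocoercive (hβ : 0 < β) (a b : Vec d) :
    Φ a ≤ Φ b + inner ℝ (p b) (a - b) - 1 / (2 * β) * N (p b - p a) ^ 2 := by
  set n := N (p b - p a) with hn
  obtain ⟨u, hu, hun⟩ := exists_dualNorm_le_one_inner_eq (N := N) (p b - p a)
  -- the point `a - (n / β) u` minimizes the descent bound at `a` against the plane at `b`
  set w := (-(n / β)) • u with hw
  have hn0 : 0 ≤ n := apply_nonneg N _
  have h1 := descent_inequality hN hsup hlip a (a + w)
  have h2 := hsup b (a + w)
  rw [add_sub_cancel_left] at h1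
  have h3 : dualNorm N w ≤ n / β := by
    rw [hw, ← dualSeminorm_apply hN, map_smul_eq_mul, norm_neg,
      Real.norm_of_nonneg (div_nonneg hn0 hβ.le), dualSeminorm_apply]
    exact mul_le_of_le_one_right (div_nonneg hn0 hβ.le) hu
  have h4 : dualNorm N w ^ 2 ≤ (n / β) ^ 2 :=
    pow_le_pow_left₀ (dualNorm_nonneg hN w) h3 2
  have h5 : inner ℝ (p b) (a + w - b) = inner ℝ (p b) (a - b) + inner ℝ (p b) w := by
    rw [← inner_add_right]
    congr 1
    abel
  have h6 : inner ℝ (p b) w - inner ℝ (p a) w = -(n / β) * n := by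
    rw [← inner_sub_left, hw, inner_smul_right, real_inner_comm, hun]
  have h7 : β / 2 * dualNorm N w ^ 2 ≤ β / 2 * (n / β) ^ 2 := by gcongr
  have h8 : -(n / β) * n + β / 2 * (n / β) ^ 2 = -(1 / (2 * β) * n ^ 2) := by
    field_simp
    ring
  linarith

/-- One round of an optimistic method: `a` is the sum of the earlier gradients, `u` the guess, and `v`
the gradient of the round. The descent inequality and co-coercivity are both used around `a + u`. -/
theorem optimistic_step (hβ : 0 < β) (a u v : Vec d) :
    inner ℝ (p (a + u)) v ≤ Φ (a + v) - Φ a + β / 2 * dualNorm N (v - u) ^ 2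
      - 1 / (2 * β) * N (p (a + u) - p a) ^ 2 := by
  have h1 := descent_inequality hN hsup hlip (a + u) (a + v)
  have h2 := cocoercive hN hsup hlip hβ a (a + u)
  rw [add_sub_add_left_eq_sub] at h1
  rw [sub_add_cancel_left, inner_neg_right] at h2
  rw [inner_sub_right] at h1
  linarith

end Smooth

/-! ### Fresh perturbations -/

/-- Integrating a function of two independent variables: freeze the first one. -/
theorem integral_comp_of_indepFun {Ω E F G : Type*} [MeasurableSpace Ω] [MeasurableSpace E]
    [MeasurableSpace F] [NormedAddCommGroup G] [NormedSpace ℝ G] {μ : Measure Ω}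
    [IsProbabilityMeasure μ] {Z : Ω → E} {S : Ω → F} (hZ : Measurable Z) (hS : Measurable S)
    (h : IndepFun Z S μ) {f : E × F → G} (hf : StronglyMeasurable f)
    (hint : Integrable (fun ω => f (Z ω, S ω)) μ) :
    ∫ ω, f (Z ω, S ω) ∂μ = ∫ ω, ∫ s, f (Z ω, s) ∂(μ.map S) ∂μ := by
  have hZS : Measurable fun ω => (Z ω, S ω) := hZ.prodMk hS
  have hmap := (indepFun_iff_map_prod_eq_prod_map_map hZ.aemeasurable hS.aemeasurable).mp h
  have : IsProbabilityMeasure (μ.map S) := Measure.isProbabilityMeasure_map hS.aemeasurable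
  have hint' : Integrable f ((μ.map Z).prod (μ.map S)) := by
    rw [← hmap]
    exact (integrable_map_measure hf.aestronglyMeasurable hZS.aemeasurable).mpr hint
  rw [← integral_map hZS.aemeasurable (f := f) hf.aestronglyMeasurable, hmap,
    integral_prod f hint', integral_map hZ.aemeasurable
      (f := fun z => ∫ s, f (z, s) ∂(μ.map S)) hf.integral_prod_right'.aestronglyMeasurable]

section Draw

variable {d m : ℕ} {X : Set (Vec d)} {P : Measure (Vec d)} [IsProbabilityMeasure P]
  {Ω : Type*}

/-- The variables `S j` are drawn from `P` independently of each other and of the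
σ-algebra `m₀`. -/
structure IsFreshDraw (m₀ : MeasurableSpace Ω) {mΩ : MeasurableSpace Ω} (μ : Measure Ω)
    (P : Measure (Vec d)) (S : Fin m → Ω → Vec d) : Prop where
  le : m₀ ≤ mΩ
  measurable : ∀ j, Measurable (S j)
  law : ∀ j, μ.map (S j) = P
  indep : iIndepFun S μ
  indep_past : Indep (⨆ j, MeasurableSpace.comap (S j) inferInstance) m₀ μ

variable {m₀ 𝒢 : MeasurableSpace Ω} {mΩ : MeasurableSpace Ω} {μ : Measure Ω}
  [IsProbabilityMeasure μ] {S z : Fin m → Ω → Vec d} {H : Ω → Vec d}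

omit [IsProbabilityMeasure P] [IsProbabilityMeasure μ] in
theorem IsFreshDraw.indepFun_of_measurable {E F : Type*} [mE : MeasurableSpace E]
    [mF : MeasurableSpace F] (h : IsFreshDraw m₀ μ P S) {Z : Ω → E} (hZ : Measurable[m₀] Z)
    {Y : Ω → F} (hY : Measurable[⨆ j, MeasurableSpace.comap (S j) inferInstance] Y) :
    IndepFun Z Y μ :=
  (IndepFun_iff_Indep ..).mpr
    (indep_of_indep_of_le h.indep_past.symm hZ.comap_le hY.comap_le)

theorem measurable_pert (S : Fin m → Ω → Vec d) (j : Fin m) :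
    Measurable[⨆ j, MeasurableSpace.comap (S j) inferInstance] (S j) :=
  Measurable.of_comap_le (le_iSup (fun j => MeasurableSpace.comap (S j) inferInstance) j)

theorem measurable_gradPhi (hP : P ≪ volume) (hX : IsCompact X) (hne : X.Nonempty) :
    Measurable (gradPhi X P) := by
  have h1 : StronglyMeasurable fun p : Vec d × Vec d => minGrad X (p.1 - p.2) :=
    (measurable_minGrad.comp (measurable_fst.sub measurable_snd)).stronglyMeasurable
  have h2 : gradPhi X P = fun g => ∫ s, minGrad X (g - s) ∂P :=
    funext fun g => gradPhi_eq hP hX hne g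
  rw [h2]
  exact h1.integral_prod_right'.measurable

/-- Almost surely, the minimizer for a fresh perturbation is the gradient of the optimal value,
hence a measurable function of the past and the perturbation. -/
theorem IsFreshDraw.ae_eq_minGrad (h : IsFreshDraw m₀ μ P S) (hP : P ≪ volume)
    (hX : IsCompact X) (hne : X.Nonempty)
    (hH : Measurable[m₀] H) (hz : ∀ j ω, z j ω ∈ linArgmin X (H ω - S j ω)) (j : Fin m) :
    ∀ᵐ ω ∂μ, z j ω = minGrad X (H ω - S j ω) := by
  have hH' : Measurable H := hH.mono h.le le_rfl
  have hind := h.indepFun_of_measurable hH (measurable_pert S j)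
  have hmap := (indepFun_iff_map_prod_eq_prod_map_map hH'.aemeasurable
    (h.measurable j).aemeasurable).mp hind
  rw [h.law j] at hmap
  have hset : MeasurableSet
      {p : Vec d × Vec d | DifferentiableAt ℝ (minVal X) (p.1 - p.2)} :=
    (measurable_fst.sub measurable_snd) (measurableSet_of_differentiableAt ℝ (minVal X))
  have hae : ∀ᵐ p ∂(μ.map fun ω => (H ω, S j ω)),
      DifferentiableAt ℝ (minVal X) (p.1 - p.2) := by
    rw [hmap]
    refine (Measure.ae_prod_iff_ae_ae hset).mpr (Filter.Eventually.of_forall fun g => ?_)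
    exact ae_differentiableAt_minVal_sub hP hX hne g
  filter_upwards [ae_of_ae_map (hH'.prodMk (h.measurable j)).aemeasurable hae] with ω hω
  exact eq_minGrad hX hω (hz j ω)

theorem integral_inner_minGrad_sub_gradPhi (hP : P ≪ volume) (hX : IsCompact X)
    (hne : X.Nonempty) (g e : Vec d) :
    ∫ s, inner ℝ e (minGrad X (g - s) - gradPhi X P g) ∂P = 0 := by
  have hi : Integrable (fun s => minGrad X (g - s) - gradPhi X P g) P :=
    (integrable_minGrad hP hX hne g).sub (integrable_const _)
  rw [integral_inner hi, integral_sub (integrable_minGrad hP hX hne g) (integrable_const _),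
    ← gradPhi_eq hP hX hne]
  simp

/-- The deviation of a minimizer from the deterministic prediction is orthogonal to everything
known before the perturbation is drawn. -/
theorem IsFreshDraw.integral_inner_sub_eq_zero (h : IsFreshDraw m₀ μ P S) (hP : P ≪ volume)
    (hX : IsCompact X) (hne : X.Nonempty)
    (hH : Measurable[m₀] H) (hz : ∀ j ω, z j ω ∈ linArgmin X (H ω - S j ω)) (j : Fin m)
    {V : Ω → Vec d} (hV : Measurable[m₀] V)
    (hint : Integrable (fun ω => inner ℝ (V ω) (z j ω - gradPhi X P (H ω))) μ) :
    ∫ ω, inner ℝ (V ω) (z j ω - gradPhi X P (H ω)) ∂μ = 0 := by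
  let F : (Vec d × Vec d) × Vec d → ℝ :=
    fun p => inner ℝ p.1.1 (minGrad X (p.1.2 - p.2) - gradPhi X P p.1.2)
  have hF : Measurable F := by
    have h1 : Measurable fun p : (Vec d × Vec d) × Vec d => minGrad X (p.1.2 - p.2) :=
      measurable_minGrad.comp (by fun_prop)
    have h2 : Measurable fun p : (Vec d × Vec d) × Vec d => gradPhi X P p.1.2 :=
      (measurable_gradPhi hP hX hne).comp (by fun_prop)
    exact (measurable_fst.comp measurable_fst).inner (h1.sub h2)
  have hae : (fun ω => inner ℝ (V ω) (z j ω - gradPhi X P (H ω)))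
      =ᵐ[μ] fun ω => F ((V ω, H ω), S j ω) := by
    filter_upwards [h.ae_eq_minGrad hP hX hne hH hz j] with ω hω
    simp only [F, hω]
  have hVH : Measurable[m₀] fun ω => (V ω, H ω) := hV.prodMk hH
  rw [integral_congr_ae hae, integral_comp_of_indepFun (hVH.mono h.le le_rfl) (h.measurable j)
    (h.indepFun_of_measurable hVH (measurable_pert S j)) hF.stronglyMeasurable (hint.congr hae),
    h.law j]
  refine integral_eq_zero_of_ae (Filter.Eventually.of_forall fun ω => ?_)
  exact integral_inner_minGrad_sub_gradPhi hP hX hne _ _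

/-- The deviations of two different minimizers of a round are uncorrelated. -/
theorem IsFreshDraw.integral_inner_eq_zero_of_ne (h : IsFreshDraw m₀ μ P S) (hP : P ≪ volume)
    (hX : IsCompact X) (hne : X.Nonempty)
    (hH : Measurable[m₀] H) (hz : ∀ j ω, z j ω ∈ linArgmin X (H ω - S j ω)) {j k : Fin m}
    (hjk : j ≠ k)
    (hint : Integrable
      (fun ω => inner ℝ (z j ω - gradPhi X P (H ω)) (z k ω - gradPhi X P (H ω))) μ) :
    ∫ ω, inner ℝ (z j ω - gradPhi X P (H ω)) (z k ω - gradPhi X P (H ω)) ∂μ = 0 := by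
  let F : Vec d × (Vec d × Vec d) → ℝ := fun p =>
    inner ℝ (minGrad X (p.1 - p.2.1) - gradPhi X P p.1) (minGrad X (p.1 - p.2.2) - gradPhi X P p.1)
  have hF : Measurable F := by
    have h1 : Measurable fun p : Vec d × (Vec d × Vec d) => minGrad X (p.1 - p.2.1) :=
      measurable_minGrad.comp (by fun_prop)
    have h2 : Measurable fun p : Vec d × (Vec d × Vec d) => minGrad X (p.1 - p.2.2) :=
      measurable_minGrad.comp (by fun_prop)
    have h3 : Measurable fun p : Vec d × (Vec d × Vec d) => gradPhi X P p.1 :=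
      (measurable_gradPhi hP hX hne).comp (by fun_prop)
    exact (h1.sub h3).inner (h2.sub h3)
  have hae : (fun ω => inner ℝ (z j ω - gradPhi X P (H ω)) (z k ω - gradPhi X P (H ω)))
      =ᵐ[μ] fun ω => F (H ω, (S j ω, S k ω)) := by
    filter_upwards [h.ae_eq_minGrad hP hX hne hH hz j, h.ae_eq_minGrad hP hX hne hH hz k]
      with ω h1 h2
    simp only [F, h1, h2]
  have hSS := (measurable_pert S j).prodMk (measurable_pert S k)
  have hjoint : μ.map (fun ω => (S j ω, S k ω)) = P.prod P := by
    rw [(indepFun_iff_map_prod_eq_prod_map_map (h.measurable j).aemeasurable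
      (h.measurable k).aemeasurable).mp (h.indep.indepFun hjk), h.law, h.law]
  rw [integral_congr_ae hae, integral_comp_of_indepFun (hH.mono h.le le_rfl)
    ((h.measurable j).prodMk (h.measurable k)) (h.indepFun_of_measurable hH hSS)
    hF.stronglyMeasurable (hint.congr hae), hjoint]
  refine integral_eq_zero_of_ae (Filter.Eventually.of_forall fun ω => ?_)
  obtain ⟨R, hR⟩ := hX.isBounded.exists_norm_le
  have hbd : ∀ g : Vec d, ∀ᵐ s ∂P, ‖minGrad X (g - s) - gradPhi X P g‖ ≤ R + ‖gradPhi X P g‖ := by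
    intro g
    filter_upwards [minGrad_ae_mem hP hX hne g] with s hs
    exact (norm_sub_le _ _).trans (by gcongr; exact hR _ hs)
  have hi : Integrable (fun q : Vec d × Vec d => F (H ω, q)) (P.prod P) := by
    have hm : Measurable fun q : Vec d × Vec d => F (H ω, q) := hF.comp (by fun_prop)
    refine Integrable.of_bound hm.aestronglyMeasurable
      ((R + ‖gradPhi X P (H ω)‖) * (R + ‖gradPhi X P (H ω)‖)) ?_
    filter_upwards [Measure.quasiMeasurePreserving_fst.ae (hbd (H ω)),
      Measure.quasiMeasurePreserving_snd.ae (hbd (H ω))] with q h1 h2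
    exact (norm_inner_le_norm _ _).trans (mul_le_mul h1 h2 (norm_nonneg _)
      ((norm_nonneg _).trans h1))
  change ∫ q, F (H ω, q) ∂(P.prod P) = 0
  rw [integral_prod _ hi]
  refine integral_eq_zero_of_ae (Filter.Eventually.of_forall fun s => ?_)
  exact integral_inner_minGrad_sub_gradPhi hP hX hne (H ω)
    (minGrad X (H ω - s) - gradPhi X P (H ω))

theorem average_mem (hXc : Convex ℝ X) (hm : 0 < m) {ω : Ω} (hz : ∀ j, z j ω ∈ X) :
    average z ω ∈ X := by
  have hm' : (m : ℝ) ≠ 0 := by positivity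
  have h := hXc.sum_mem (t := Finset.univ) (w := fun _ : Fin m => (m : ℝ)⁻¹) (z := fun j => z j ω)
    (fun _ _ => by positivity) (by simp [hm']) (fun j _ => hz j)
  rwa [← Finset.smul_sum] at h

theorem average_sub (hm : 0 < m) (ω : Ω) (a : Vec d) :
    average z ω - a = (m : ℝ)⁻¹ • ∑ j, (z j ω - a) := by
  have hm' : (m : ℝ) ≠ 0 := by positivity
  rw [average, Finset.sum_sub_distrib, smul_sub, Finset.sum_const, Finset.card_univ,
    Fintype.card_fin, ← Nat.cast_smul_eq_nsmul ℝ, smul_smul, inv_mul_cancel₀ hm', one_smul]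

theorem measurable_average {Ω : Type*} [MeasurableSpace Ω] {z : Fin m → Ω → Vec d}
    (hzm : ∀ j, Measurable (z j)) : Measurable (average z) :=
  (Finset.measurable_fun_sum Finset.univ fun j _ => hzm j).const_smul (m : ℝ)⁻¹

/-- Averaging `m` samples divides the variance by `m`. -/
theorem IsFreshDraw.integral_norm_sq_le (h : IsFreshDraw m₀ μ P S) (hP : P ≪ volume)
    (hX : IsCompact X) (hXc : Convex ℝ X) (hne : X.Nonempty) (hm : 0 < m)
    (hH : Measurable[m₀] H) (hzm : ∀ j, Measurable (z j))
    (hz : ∀ j ω, z j ω ∈ linArgmin X (H ω - S j ω))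
    {R : ℝ} (hR : ∀ a ∈ X, ∀ b ∈ X, ‖a - b‖ ≤ R) :
    ∫ ω, ‖average z ω - gradPhi X P (H ω)‖ ^ 2 ∂μ ≤ R ^ 2 / m := by
  have hHm : Measurable fun ω => gradPhi X P (H ω) :=
    (measurable_gradPhi hP hX hne).comp (hH.mono h.le le_rfl)
  have hb : ∀ j ω, ‖z j ω - gradPhi X P (H ω)‖ ≤ R := fun j ω =>
    hR _ (hz j ω).1 _ (gradPhi_mem hP hX hXc hne _)
  have hint : ∀ j k, Integrable
      (fun ω => inner ℝ (z j ω - gradPhi X P (H ω)) (z k ω - gradPhi X P (H ω))) μ := fun j k => by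
    refine Integrable.of_bound
      (((hzm j).sub hHm).inner ((hzm k).sub hHm)).aestronglyMeasurable (R * R)
      (Filter.Eventually.of_forall fun ω => ?_)
    exact (norm_inner_le_norm _ _).trans
      (mul_le_mul (hb j ω) (hb k ω) (norm_nonneg _) ((norm_nonneg _).trans (hb j ω)))
  have hexp : ∀ ω, ‖average z ω - gradPhi X P (H ω)‖ ^ 2 = ((m : ℝ)⁻¹) ^ 2 *
      ∑ j, ∑ k, inner ℝ (z j ω - gradPhi X P (H ω)) (z k ω - gradPhi X P (H ω)) := fun ω => by
    rw [average_sub hm, norm_smul, mul_pow, Real.norm_of_nonneg (by positivity),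
      ← real_inner_self_eq_norm_sq, sum_inner]
    simp_rw [inner_sum]
  simp_rw [hexp]
  rw [integral_const_mul,
    integral_finsetSum _ fun j _ => integrable_finsetSum _ fun k _ => hint j k]
  have hsum : ∀ j, ∫ ω, ∑ k, inner ℝ (z j ω - gradPhi X P (H ω)) (z k ω - gradPhi X P (H ω)) ∂μ
      ≤ R ^ 2 := fun j => by
    rw [integral_finsetSum _ fun k _ => hint j k, Finset.sum_eq_single j
      (fun k _ hk => h.integral_inner_eq_zero_of_ne hP hX hne hH hz (Ne.symm hk) (hint j k))
      (by simp)]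
    refine (integral_mono (hint j j) (integrable_const (R ^ 2)) fun ω => ?_).trans_eq (by simp)
    change inner ℝ _ _ ≤ _
    rw [real_inner_self_eq_norm_sq]
    exact pow_le_pow_left₀ (norm_nonneg _) (hb j ω) 2
  have hm' : (m : ℝ) ≠ 0 := by positivity
  calc ((m : ℝ)⁻¹) ^ 2 * ∑ j, ∫ ω, ∑ k,
          inner ℝ (z j ω - gradPhi X P (H ω)) (z k ω - gradPhi X P (H ω)) ∂μ
      ≤ ((m : ℝ)⁻¹) ^ 2 * ∑ _j : Fin m, R ^ 2 := by
        gcongr with j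
        exact hsum j
    _ = R ^ 2 / m := by
        rw [Finset.sum_const, Finset.card_univ, Fintype.card_fin, nsmul_eq_mul]
        field_simp

/-- The conditional expectation of the averaged prediction is the deterministic prediction. -/
theorem IsFreshDraw.condExp_average (h : IsFreshDraw m₀ μ P S) (hP : P ≪ volume)
    (hX : IsCompact X) (hXc : Convex ℝ X) (hne : X.Nonempty) (hm : 0 < m)
    (h𝒢 : 𝒢 ≤ m₀)
    (hH : Measurable[𝒢] H) (hzm : ∀ j, Measurable (z j))
    (hz : ∀ j ω, z j ω ∈ linArgmin X (H ω - S j ω)) :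
    μ[average z | 𝒢] =ᵐ[μ] fun ω => gradPhi X P (H ω) := by
  obtain ⟨R, hR⟩ := hX.isBounded.exists_norm_le
  have hH0 : Measurable[m₀] H := hH.mono h𝒢 le_rfl
  have hG : Measurable[𝒢] fun ω => gradPhi X P (H ω) := (measurable_gradPhi hP hX hne).comp hH
  have hGm : Measurable fun ω => gradPhi X P (H ω) := hG.mono (h𝒢.trans h.le) le_rfl
  have hzi : ∀ j, Integrable (fun ω => z j ω - gradPhi X P (H ω)) μ := fun j =>
    Integrable.of_bound ((hzm j).sub hGm).aestronglyMeasurable (R + R)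
      (Filter.Eventually.of_forall fun ω => (norm_sub_le _ _).trans
        (add_le_add (hR _ (hz j ω).1) (hR _ (gradPhi_mem hP hX hXc hne _))))
  have hai : Integrable (average z) μ :=
    Integrable.of_bound (measurable_average hzm).aestronglyMeasurable R
      (Filter.Eventually.of_forall fun ω => hR _ (average_mem hXc hm fun j => (hz j ω).1))
  have hgi : Integrable (fun ω => gradPhi X P (H ω)) μ :=
    Integrable.of_bound hGm.aestronglyMeasurable R
      (Filter.Eventually.of_forall fun ω => hR _ (gradPhi_mem hP hX hXc hne _))
  refine (ae_eq_condExp_of_forall_setIntegral_eq (h𝒢.trans h.le) hai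
    (fun _ _ _ => hgi.integrableOn) (fun B hB _ => ?_)
    hG.stronglyMeasurable.aestronglyMeasurable).symm
  symm
  have hBm : MeasurableSet B := h.le _ (h𝒢 _ hB)
  -- pairing with `e` over `B` is pairing with the past variable `1_B e`
  have hj : ∀ j, ∫ ω in B, (z j ω - gradPhi X P (H ω)) ∂μ = 0 := fun j => by
    refine ext_inner_left ℝ fun e => ?_
    rw [inner_zero_right, ← integral_inner (hzi j).integrableOn, ← integral_indicator hBm]
    have hV : Measurable[m₀] (B.indicator fun _ => e) := measurable_const.indicator (h𝒢 _ hB)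
    have heq : (B.indicator fun ω => inner ℝ e (z j ω - gradPhi X P (H ω)))
        = fun ω => inner ℝ (B.indicator (fun _ => e) ω) (z j ω - gradPhi X P (H ω)) := by
      funext ω
      by_cases hω : ω ∈ B <;> simp [hω]
    rw [heq]
    refine h.integral_inner_sub_eq_zero hP hX hne hH0 hz j hV ?_
    rw [← heq]
    exact ((hzi j).const_inner e).indicator hBm
  rw [← sub_eq_zero, ← integral_sub hai.integrableOn hgi.integrableOn]
  simp_rw [average_sub hm]
  rw [integral_smul, integral_finsetSum _ fun j _ => (hzi j).integrableOn]
  simp [hj]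

end Draw

/-! ### Convex losses with Hölder gradients -/

section Loss

variable {d : ℕ} {X : Set (Vec d)}

/-- The gradient inequality for a convex function differentiable within its domain. -/
theorem inner_gradient_le_sub {f : Vec d → ℝ} {v y z : Vec d} (hf : ConvexOn ℝ X f)
    (hv : HasGradientWithinAt f v X y) (hy : y ∈ X) (hz : z ∈ X) :
    inner ℝ v (z - y) ≤ f z - f y := by
  have hline : HasDerivWithinAt (fun t : ℝ => y + t • (z - y)) (z - y) (Set.Ioc 0 1) 0 := by
    simpa using (((hasDerivAt_id (0 : ℝ)).smul_const (z - y)).const_add y).hasDerivWithinAt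
  have hmaps : Set.MapsTo (fun t : ℝ => y + t • (z - y)) (Set.Ioc 0 1) X := fun t ht =>
    hf.1.add_smul_sub_mem hy hz ⟨ht.1.le, ht.2⟩
  have hfd : HasFDerivWithinAt f (InnerProductSpace.toDual ℝ (Vec d) v) X
      (y + (0 : ℝ) • (z - y)) := by
    simpa using hv.hasFDerivWithinAt
  have hcomp := hfd.comp_hasDerivWithinAt (0 : ℝ) hline hmaps
  rw [hasDerivWithinAt_iff_tendsto_slope' (by simp)] at hcomp
  have : (nhdsWithin (0 : ℝ) (Set.Ioc 0 1)).NeBot := left_nhdsWithin_Ioc_neBot one_pos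
  refine le_of_tendsto hcomp ?_
  filter_upwards [self_mem_nhdsWithin] with t ht
  rw [slope_def_field, sub_zero, div_le_iff₀ ht.1]
  have h := hf.2 hy hz (sub_nonneg.mpr ht.2) ht.1.le (by ring)
  have he : (1 - t) • y + t • z = y + t • (z - y) := by module
  rw [he, smul_eq_mul, smul_eq_mul] at h
  simp only [Function.comp_apply, zero_smul, add_zero]
  linarith

theorem abs_inner_le_mul_dualNorm {N : Seminorm ℝ (Vec d)} (hN : ∀ v, N v = 0 → v = 0)
    (u v : Vec d) : |inner ℝ u v| ≤ dualNorm N u * N v := by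
  rw [real_inner_comm, abs_le, mul_comm]
  have h1 := inner_le_mul_dualNorm hN v u
  have h2 := inner_le_mul_dualNorm hN (-v) u
  rw [inner_neg_left, map_neg_eq_map] at h2
  exact ⟨by linarith, h1⟩

/-- Linear functionals on `X` are controlled by their values at finitely many points of `X`, even
when `X` has empty interior: choose a basis of the direction of `X` among differences. -/
theorem exists_finset_abs_inner_le (hX : IsCompact X) (y₀ : Vec d) :
    ∃ s : Finset (Vec d), ↑s ⊆ X ∧ ∃ K : ℝ, 0 ≤ K ∧ ∀ v : Vec d, ∀ x ∈ X,
      |inner ℝ v (x - y₀)| ≤ K * ∑ y ∈ s, |inner ℝ v (y - y₀)| := by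
  classical
  obtain ⟨b, hbX, -, hspan, hli⟩ :=
    Submodule.exists_finset_span_eq_linearIndepOn ℝ ((fun x => x - y₀) '' X)
  let W := Submodule.span ℝ (Set.range fun i : (b : Set (Vec d)) => id (i : Vec d))
  let B : Module.Basis (b : Set (Vec d)) ℝ W := Module.Basis.span hli
  have hW : ∀ x ∈ X, x - y₀ ∈ W := fun x hx => by
    have h1 : x - y₀ ∈ Submodule.span ℝ ((fun x => x - y₀) '' X) :=
      Submodule.subset_span ⟨x, hx, rfl⟩
    rw [← hspan] at h1
    simpa [W] using h1
  obtain ⟨R, hR0, hR⟩ : ∃ R > 0, ∀ x ∈ X, ‖x - y₀‖ ≤ R := by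
    obtain ⟨R, hR0, hR⟩ := hX.isBounded.exists_pos_norm_le
    refine ⟨R + ‖y₀‖, by positivity, fun x hx => (norm_sub_le _ _).trans ?_⟩
    gcongr
    exact hR x hx
  let φ : W →L[ℝ] (↥(b : Set (Vec d)) → ℝ) :=
    LinearMap.toContinuousLinearMap B.equivFun.toLinearMap
  refine ⟨b.image fun e => e + y₀, ?_, ‖φ‖ * R, by positivity, fun v x hx => ?_⟩
  · intro e he
    obtain ⟨e', he', rfl⟩ := Finset.mem_image.mp (Finset.mem_coe.mp he)
    obtain ⟨x, hx, rfl⟩ := hbX he'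
    simpa using hx
  · rw [Finset.sum_image (fun _ _ _ _ h => add_right_cancel h)]
    simp only [add_sub_cancel_right]
    let w : W := ⟨x - y₀, hW x hx⟩
    have hrep : x - y₀ = ∑ i, φ w i • (i : Vec d) := by
      have h1 := congrArg (Subtype.val) (B.sum_equivFun w)
      rw [Submodule.coe_sum] at h1
      refine h1.symm.trans (Finset.sum_congr rfl fun i _ => ?_)
      rw [Submodule.coe_smul, show (B i : Vec d) = i from
        congrArg Subtype.val (Module.Basis.span_apply hli i)]
      rfl
    have hcoef : ∀ i, |φ w i| ≤ ‖φ‖ * R := fun i => by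
      refine ((norm_le_pi_norm (φ w) i).trans (φ.le_opNorm w)).trans ?_
      gcongr
      exact hR x hx
    rw [hrep, inner_sum, Finset.mul_sum, ← Finset.sum_coe_sort b]
    refine (Finset.abs_sum_le_sum_abs _ _).trans (Finset.sum_le_sum fun i _ => ?_)
    rw [inner_smul_right, abs_mul]
    gcongr
    exact hcoef i

/-- The increments of `f` over `X`, and the pairings of its gradients with directions of `X`, are
bounded in terms of finitely many values of `f`. -/
theorem exists_finset_abs_gradient_le {N : Seminorm ℝ (Vec d)} (hN : ∀ v, N v = 0 → v = 0)
    (hX : IsCompact X) {y₀ : Vec d} (hy₀ : y₀ ∈ X) {L α : ℝ} (hL : 0 ≤ L) (hα : 0 ≤ α) :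
    ∃ s : Finset (Vec d), ↑s ⊆ X ∧ ∃ K c : ℝ, ∀ (f : Vec d → ℝ) (gr : Vec d → Vec d),
      ConvexOn ℝ X f → (∀ y ∈ X, HasGradientWithinAt f (gr y) X y) →
      (∀ y₁ ∈ X, ∀ y₂ ∈ X, dualNorm N (gr y₁ - gr y₂) ≤ L * N (y₁ - y₂) ^ α) →
      ∀ z ∈ X, (∀ y ∈ X, |inner ℝ (gr z) (y - y₀)| ≤ K * ∑ y ∈ s, (|f y - f y₀| + c) + c) ∧
        |f z - f y₀| ≤ K * ∑ y ∈ s, (|f y - f y₀| + c) + c := by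
  obtain ⟨s, hsX, K, hK, hs⟩ := exists_finset_abs_inner_le hX y₀
  have hD := diameter_nonneg (N := N) X
  set c := L * diameter N X ^ α * diameter N X with hc
  have hc0 : 0 ≤ c := by positivity
  refine ⟨s, hsX, K, c, fun f gr hf hgr hh z hz => ?_⟩
  -- `c` bounds the effect of moving the base point of the gradient to `y₀`
  have hdiff : ∀ z ∈ X, ∀ y ∈ X, |inner ℝ (gr z - gr y₀) (y - y₀)| ≤ c := fun z hz y hy => by
    refine (abs_inner_le_mul_dualNorm hN _ _).trans ?_
    have h1 : dualNorm N (gr z - gr y₀) ≤ L * diameter N X ^ α := by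
      refine (hh z hz y₀ hy₀).trans ?_
      gcongr
      exact le_diameter hX hz hy₀
    exact mul_le_mul h1 (le_diameter hX hy hy₀) (apply_nonneg N _) (by positivity)
  have hlow : ∀ y ∈ X, inner ℝ (gr y₀) (y - y₀) ≤ f y - f y₀ := fun y hy =>
    inner_gradient_le_sub hf (hgr y₀ hy₀) hy₀ hy
  have hup : ∀ y ∈ X, f y - f y₀ ≤ inner ℝ (gr y) (y - y₀) := fun y hy => by
    have h := inner_gradient_le_sub hf (hgr y hy) hy hy₀
    rw [← neg_sub y y₀, inner_neg_right] at h
    linarith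
  have hpt : ∀ y ∈ X, |inner ℝ (gr y₀) (y - y₀)| ≤ |f y - f y₀| + c := fun y hy => by
    have h1 := hdiff y hy y hy
    rw [inner_sub_left] at h1
    have h2 := abs_le.mp h1
    rw [abs_le]
    have h3 := hlow y hy
    have h4 := hup y hy
    exact ⟨by linarith [neg_abs_le (f y - f y₀)], by linarith [le_abs_self (f y - f y₀)]⟩
  have hbase : ∀ y ∈ X, |inner ℝ (gr y₀) (y - y₀)| ≤ K * ∑ y ∈ s, (|f y - f y₀| + c) :=
    fun y hy => (hs _ y hy).trans (by gcongr with y' hy'; exact hpt y' (hsX hy'))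
  have hall : ∀ y ∈ X, |inner ℝ (gr z) (y - y₀)| ≤ K * ∑ y ∈ s, (|f y - f y₀| + c) + c :=
    fun y hy => by
      have h1 := hdiff z hz y hy
      rw [inner_sub_left] at h1
      have h2 := abs_sub_abs_le_abs_sub (inner ℝ (gr z) (y - y₀)) (inner ℝ (gr y₀) (y - y₀))
      linarith [hbase y hy]
  refine ⟨hall, ?_⟩
  rw [abs_le]
  have h1 := abs_le.mp (hbase z hz)
  have h2 := abs_le.mp (hall z hz)
  exact ⟨by linarith [hlow z hz], by linarith [hup z hz]⟩

end Loss

/-- Jensen's inequality between the moments of order `1 + α ≤ 2` and `2`. -/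
theorem integral_rpow_one_add_le {Ω : Type*} [MeasurableSpace Ω] {μ : Measure Ω}
    [IsProbabilityMeasure μ] {n : Ω → ℝ} (hn : Measurable n) (hn0 : ∀ ω, 0 ≤ n ω) {B : ℝ}
    (hB : ∀ ω, n ω ≤ B) {c α : ℝ} (hc : 0 ≤ c) (hα : α ∈ Set.Icc (0 : ℝ) 1)
    (h : ∫ ω, n ω ^ 2 ∂μ ≤ c ^ 2) : ∫ ω, n ω ^ (1 + α) ∂μ ≤ c ^ (1 + α) := by
  obtain ⟨h0, h1⟩ := hα
  have hp0 : 0 ≤ (1 + α) / 2 := by linarith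
  have hpow : ∀ r : ℝ, 0 ≤ r → (r ^ 2) ^ ((1 + α) / 2) = r ^ (1 + α) := fun r hr => by
    rw [← Real.rpow_natCast, ← Real.rpow_mul hr]
    congr 1
    push_cast
    ring
  have hi : Integrable (fun ω => n ω ^ 2) μ := by
    refine Integrable.of_bound (hn.pow_const 2).aestronglyMeasurable (B ^ 2)
      (Filter.Eventually.of_forall fun ω => ?_)
    rw [Real.norm_of_nonneg (by positivity)]
    exact pow_le_pow_left₀ (hn0 ω) (hB ω) 2
  have hi' : Integrable (fun ω => (n ω ^ 2) ^ ((1 + α) / 2)) μ := by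
    refine Integrable.of_bound ((hn.pow_const 2).pow_const _).aestronglyMeasurable
      ((B ^ 2) ^ ((1 + α) / 2)) (Filter.Eventually.of_forall fun ω => ?_)
    rw [Real.norm_of_nonneg (by positivity)]
    exact Real.rpow_le_rpow (by positivity) (pow_le_pow_left₀ (hn0 ω) (hB ω) 2) hp0
  have hj := (Real.concaveOn_rpow hp0 (by linarith)).le_map_integral
    (Real.continuous_rpow_const hp0).continuousOn isClosed_Ici
    (Filter.Eventually.of_forall fun ω => Set.mem_Ici.mpr (sq_nonneg (n ω))) hi hi'
  simp only [hpow _ (hn0 _)] at hj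
  refine hj.trans ?_
  rw [← hpow c hc]
  exact Real.rpow_le_rpow (integral_nonneg fun ω => by positivity) h hp0

section Round

variable {d m : ℕ} {N : Seminorm ℝ (Vec d)} {X : Set (Vec d)} {P : Measure (Vec d)}
  [IsProbabilityMeasure P] {Ω : Type*} {m₀ : MeasurableSpace Ω} {mΩ : MeasurableSpace Ω}
  {μ : Measure Ω} [IsProbabilityMeasure μ] {S z : Fin m → Ω → Vec d} {H : Ω → Vec d}
  {f : Ω → Vec d → ℝ} {gr : Ω → Vec d → Vec d} {L α : ℝ}

theorem measurable_gradient_comp {Ω : Type*} {m₁ : MeasurableSpace Ω} {gr : Ω → Vec d → Vec d}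
    (hgr : Measurable fun p : Ω × X => gr p.1 p.2)
    {w : Ω → Vec d} (hw : Measurable w) (hwX : ∀ ω, w ω ∈ X) : Measurable fun ω => gr ω (w ω) :=
  hgr.comp (measurable_id.prodMk (hw.subtype_mk (h := hwX)))

/-- Random losses of integrable values have increments and gradient pairings over `X` with an
integrable envelope. -/
theorem exists_integrable_envelope (hN : ∀ v, N v = 0 → v = 0) (hX : IsCompact X)
    {y₀ : Vec d} (hy₀ : y₀ ∈ X) (hL : 0 ≤ L) (hα : 0 ≤ α)
    (hconv : ∀ ω, ConvexOn ℝ X (f ω))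
    (hgrad : ∀ ω, ∀ y ∈ X, HasGradientWithinAt (f ω) (gr ω y) X y)
    (hholder : ∀ ω, ∀ y₁ ∈ X, ∀ y₂ ∈ X,
      dualNorm N (gr ω y₁ - gr ω y₂) ≤ L * N (y₁ - y₂) ^ α)
    (hfint : ∀ y ∈ X, Integrable (fun ω => f ω y) μ) :
    ∃ E : Ω → ℝ, Integrable E μ ∧ ∀ ω, ∀ w ∈ X,
      (∀ y₁ ∈ X, ∀ y₂ ∈ X, |inner ℝ (gr ω w) (y₁ - y₂)| ≤ E ω) ∧
      ∀ y ∈ X, |f ω w - f ω y| ≤ E ω := by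
  obtain ⟨s, hsX, K, c, h⟩ := exists_finset_abs_gradient_le hN hX hy₀ hL hα
  let E : Ω → ℝ := fun ω => K * ∑ y ∈ s, (|f ω y - f ω y₀| + c) + c
  have hE : Integrable E μ := by
    refine ((integrable_finsetSum _ fun y hy => ?_).const_mul K).add (integrable_const _)
    exact ((hfint y (hsX hy)).sub (hfint y₀ hy₀)).abs.add (integrable_const _)
  refine ⟨fun ω => E ω + E ω, hE.add hE, fun ω w hw => ⟨fun y₁ h₁ y₂ h₂ => ?_, fun y hy => ?_⟩⟩
  · have h3 := (h _ _ (hconv ω) (hgrad ω) (hholder ω) w hw).1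
    rw [← sub_sub_sub_cancel_right y₁ y₂ y₀, inner_sub_right]
    exact (abs_sub _ _).trans (add_le_add (h3 y₁ h₁) (h3 y₂ h₂))
  · have h1 := (h _ _ (hconv ω) (hgrad ω) (hholder ω) w hw).2
    have h2 := (h _ _ (hconv ω) (hgrad ω) (hholder ω) y hy).2
    rw [← sub_sub_sub_cancel_right (f ω w) (f ω y) (f ω y₀)]
    exact (abs_sub _ _).trans (add_le_add h1 h2)

omit [IsProbabilityMeasure μ] in
theorem measurable_loss_comp (hgrad : ∀ ω, ∀ y ∈ X, HasGradientWithinAt (f ω) (gr ω y) X y)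
    (hf : ∀ y ∈ X, Measurable fun ω => f ω y)
    {w : Ω → Vec d} (hw : Measurable w) (hwX : ∀ ω, w ω ∈ X) :
    Measurable fun ω => f ω (w ω) := by
  have h : Measurable (Function.uncurry fun (y : X) (ω : Ω) => f ω y) := by
    refine measurable_uncurry_of_continuous_of_measurable (fun ω => ?_) fun y => hf y y.2
    have hc : ContinuousOn (f ω) X := fun y hy => (hgrad ω y hy).continuousWithinAt
    exact hc.domRestrict
  exact h.comp ((hw.subtype_mk (h := hwX)).prodMk measurable_id)

theorem integrable_loss_sub (hN : ∀ v, N v = 0 → v = 0) (hX : IsCompact X)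
    (hL : 0 ≤ L) (hα : 0 ≤ α)
    (hconv : ∀ ω, ConvexOn ℝ X (f ω))
    (hgrad : ∀ ω, ∀ y ∈ X, HasGradientWithinAt (f ω) (gr ω y) X y)
    (hholder : ∀ ω, ∀ y₁ ∈ X, ∀ y₂ ∈ X,
      dualNorm N (gr ω y₁ - gr ω y₂) ≤ L * N (y₁ - y₂) ^ α)
    (hf : ∀ y ∈ X, Measurable fun ω => f ω y)
    (hfint : ∀ y ∈ X, Integrable (fun ω => f ω y) μ)
    {w : Ω → Vec d} (hw : Measurable w) (hwX : ∀ ω, w ω ∈ X) {y : Vec d} (hy : y ∈ X) :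
    Integrable (fun ω => f ω (w ω) - f ω y) μ := by
  obtain ⟨E, hE, hb⟩ := exists_integrable_envelope hN hX hy hL hα hconv hgrad hholder hfint
  exact hE.mono' ((measurable_loss_comp hgrad hf hw hwX).sub (hf y hy)).aestronglyMeasurable
    (Filter.Eventually.of_forall fun ω => (hb ω _ (hwX ω)).2 y hy)

/-- The price of sampling: replacing the expected prediction by the average of `m` minimizers costs
a term that the Hölder condition on the gradients makes of second order. -/
theorem IsFreshDraw.integral_inner_gradient_le (h : IsFreshDraw m₀ μ P S)
    (hN : ∀ v, N v = 0 → v = 0) (hP : P ≪ volume)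
    (hX : IsCompact X) (hXc : Convex ℝ X) (hne : X.Nonempty) (hm : 0 < m)
    (hH : Measurable[m₀] H) (hzm : ∀ j, Measurable (z j))
    (hz : ∀ j ω, z j ω ∈ linArgmin X (H ω - S j ω))
    (hL : 0 ≤ L) (hα : α ∈ Set.Icc (0 : ℝ) 1)
    (hconv : ∀ ω, ConvexOn ℝ X (f ω))
    (hgrad : ∀ ω, ∀ y ∈ X, HasGradientWithinAt (f ω) (gr ω y) X y)
    (hholder : ∀ ω, ∀ y₁ ∈ X, ∀ y₂ ∈ X,
      dualNorm N (gr ω y₁ - gr ω y₂) ≤ L * N (y₁ - y₂) ^ α)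
    (hgr : Measurable[m₀.prod inferInstance] (fun p : Ω × X => gr p.1 p.2))
    (hfint : ∀ y ∈ X, Integrable (fun ω => f ω y) μ) :
    Integrable (fun ω => inner ℝ (gr ω (average z ω)) (average z ω - gradPhi X P (H ω))) μ ∧
    ∫ ω, inner ℝ (gr ω (average z ω)) (average z ω - gradPhi X P (H ω)) ∂μ ≤
      L * (compatOne N * compatTwo N * diameter N X / Real.sqrt m) ^ (1 + α) := by
  obtain ⟨y₀, hy₀⟩ := hne
  have hne : X.Nonempty := ⟨y₀, hy₀⟩
  obtain ⟨E, hE, hb⟩ := exists_integrable_envelope hN hX hy₀ hL hα.1 hconv hgrad hholder hfint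
  have hgrΩ : Measurable (fun p : Ω × X => gr p.1 p.2) :=
    hgr.mono (sup_le_sup (MeasurableSpace.comap_mono h.le) le_rfl) le_rfl
  have havm : Measurable (average z) := measurable_average hzm
  have havX : ∀ ω, average z ω ∈ X := fun ω => average_mem hXc hm fun j => (hz j ω).1
  have ha0 : Measurable[m₀] fun ω => gradPhi X P (H ω) := (measurable_gradPhi hP hX hne).comp hH
  have ham : Measurable fun ω => gradPhi X P (H ω) := ha0.mono h.le le_rfl
  have haX : ∀ ω, gradPhi X P (H ω) ∈ X := fun ω => gradPhi_mem hP hX hXc hne _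
  have hV0 : Measurable[m₀] fun ω => gr ω (gradPhi X P (H ω)) :=
    measurable_gradient_comp hgr ha0 haX
  have hVm := hV0.mono h.le le_rfl
  have hUm : Measurable fun ω => gr ω (average z ω) := measurable_gradient_comp hgrΩ havm havX
  have hint : ∀ {u w : Ω → Vec d}, Measurable (fun ω => gr ω (u ω)) → (∀ ω, u ω ∈ X) →
      Measurable w → (∀ ω, w ω ∈ X) →
      Integrable (fun ω => inner ℝ (gr ω (u ω)) (w ω - gradPhi X P (H ω))) μ :=
    fun hu huX hw hwX => hE.mono' (hu.inner (hw.sub ham)).aestronglyMeasurable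
      (Filter.Eventually.of_forall fun ω => (hb ω _ (huX ω)).1 _ (hwX ω) _ (haX ω))
  have hI1 := hint hUm havX havm havX
  have hI2 := hint hVm haX havm havX
  refine ⟨hI1, ?_⟩
  -- the gradient at the expected prediction is known before the perturbations are drawn
  have hzero : ∫ ω, inner ℝ (gr ω (gradPhi X P (H ω))) (average z ω - gradPhi X P (H ω)) ∂μ
      = 0 := by
    have hIj := fun j => hint hVm haX (hzm j) fun ω => (hz j ω).1
    simp_rw [average_sub hm, inner_smul_right, inner_sum]
    rw [integral_const_mul, integral_finsetSum _ fun j _ => hIj j]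
    simp [h.integral_inner_sub_eq_zero hP hX hne hH hz _ hV0 (hIj _)]
  have hnm : Measurable fun ω => N (average z ω - gradPhi X P (H ω)) :=
    measurable_seminorm.comp (havm.sub ham)
  have hnb : ∀ ω, N (average z ω - gradPhi X P (H ω)) ≤ diameter N X := fun ω =>
    le_diameter hX (havX ω) (haX ω)
  have hα0 : 0 ≤ 1 + α := by linarith [hα.1]
  have hpi : Integrable (fun ω => N (average z ω - gradPhi X P (H ω)) ^ (1 + α)) μ := by
    refine Integrable.of_bound (hnm.pow_const _).aestronglyMeasurable (diameter N X ^ (1 + α))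
      (Filter.Eventually.of_forall fun ω => ?_)
    rw [Real.norm_of_nonneg (Real.rpow_nonneg (apply_nonneg N _) _)]
    exact Real.rpow_le_rpow (apply_nonneg N _) (hnb ω) hα0
  have hsq : ∫ ω, N (average z ω - gradPhi X P (H ω)) ^ 2 ∂μ ≤
      (compatOne N * compatTwo N * diameter N X / Real.sqrt m) ^ 2 := by
    have hvar := h.integral_norm_sq_le hP hX hXc hne hm hH hzm hz
      (R := compatTwo N * diameter N X) fun a ha b hb =>
        (compatTwo_bound hN _).trans (by
          have := compatTwo_nonneg (N := N)
          gcongr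
          exact le_diameter hX ha hb)
    have hi : Integrable (fun ω => ‖average z ω - gradPhi X P (H ω)‖ ^ 2) μ := by
      obtain ⟨R, hR⟩ := hX.isBounded.exists_norm_le
      refine Integrable.of_bound ((havm.sub ham).norm.pow_const 2).aestronglyMeasurable
        ((R + R) ^ 2) (Filter.Eventually.of_forall fun ω => ?_)
      rw [Real.norm_of_nonneg (by positivity)]
      exact pow_le_pow_left₀ (norm_nonneg _)
        ((norm_sub_le _ _).trans (add_le_add (hR _ (havX ω)) (hR _ (haX ω)))) 2
    calc ∫ ω, N (average z ω - gradPhi X P (H ω)) ^ 2 ∂μ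
        ≤ ∫ ω, compatOne N ^ 2 * ‖average z ω - gradPhi X P (H ω)‖ ^ 2 ∂μ := by
          refine integral_mono_of_nonneg (Filter.Eventually.of_forall fun ω => sq_nonneg _)
            (hi.const_mul _) (Filter.Eventually.of_forall fun ω => ?_)
          simp only [← mul_pow]
          exact pow_le_pow_left₀ (apply_nonneg N _) (compatOne_bound _) 2
      _ ≤ compatOne N ^ 2 * ((compatTwo N * diameter N X) ^ 2 / m) := by
          rw [integral_const_mul]
          gcongr
      _ = (compatOne N * compatTwo N * diameter N X / Real.sqrt m) ^ 2 := by
          rw [div_pow, Real.sq_sqrt (by positivity)]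
          ring
  have hjensen := integral_rpow_one_add_le hnm (fun ω => apply_nonneg N _) hnb
    (c := compatOne N * compatTwo N * diameter N X / Real.sqrt m)
    (by
      have := compatOne_nonneg (N := N)
      have := compatTwo_nonneg (N := N)
      have := diameter_nonneg (N := N) X
      positivity) hα hsq
  calc ∫ ω, inner ℝ (gr ω (average z ω)) (average z ω - gradPhi X P (H ω)) ∂μ
      = ∫ ω, inner ℝ (gr ω (average z ω)) (average z ω - gradPhi X P (H ω)) ∂μ
        - ∫ ω, inner ℝ (gr ω (gradPhi X P (H ω))) (average z ω - gradPhi X P (H ω)) ∂μ := by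
        rw [hzero, sub_zero]
    _ = ∫ ω, (inner ℝ (gr ω (average z ω)) (average z ω - gradPhi X P (H ω))
        - inner ℝ (gr ω (gradPhi X P (H ω))) (average z ω - gradPhi X P (H ω))) ∂μ :=
        (integral_sub hI1 hI2).symm
    _ ≤ ∫ ω, L * N (average z ω - gradPhi X P (H ω)) ^ (1 + α) ∂μ := by
        refine integral_mono (hI1.sub hI2) (hpi.const_mul L) fun ω => ?_
        simp only [← inner_sub_left]
        have hn0 : 0 ≤ N (average z ω - gradPhi X P (H ω)) := apply_nonneg N _
        refine (le_abs_self _).trans ((abs_inner_le_mul_dualNorm hN _ _).trans ?_)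
        rw [Real.rpow_add_of_nonneg hn0 zero_le_one hα.1, Real.rpow_one]
        calc _ ≤ L * N (average z ω - gradPhi X P (H ω)) ^ α
              * N (average z ω - gradPhi X P (H ω)) := by
              gcongr
              exact hholder ω _ (havX ω) _ (haX ω)
          _ = _ := by ring
    _ ≤ _ := by
        rw [integral_const_mul]
        gcongr

end Round

/-! ### Regret of the deterministic predictions -/

section Deterministic

variable {d : ℕ} {N : Seminorm ℝ (Vec d)} {X : Set (Vec d)} {P : Measure (Vec d)}
  [IsProbabilityMeasure P]

omit [IsProbabilityMeasure P] in
theorem integrable_id_of_dualNorm (hN : ∀ v, N v = 0 → v = 0)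
    (hPint : Integrable (fun s => dualNorm N s) P) : Integrable (fun s : Vec d => s) P := by
  obtain ⟨K, -, hK⟩ := exists_norm_le_mul_seminorm (dualSeminorm_eq_zero hN)
  exact (hPint.const_mul K).mono' measurable_id.aestronglyMeasurable
    (Filter.Eventually.of_forall hK)

omit [IsProbabilityMeasure P] in
/-- An absolutely continuous perturbation in positive dimension does not vanish. -/
theorem integral_dualNorm_pos (hd : 0 < d) (hN : ∀ v, N v = 0 → v = 0) [NeZero P]
    (hP : P ≪ volume) (hPint : Integrable (fun s => dualNorm N s) P) :
    0 < ∫ s, dualNorm N s ∂P := by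
  have : Nonempty (Fin d) := ⟨⟨0, hd⟩⟩
  rw [integral_pos_iff_support_of_nonneg (dualNorm_nonneg hN) hPint]
  have hsupp : Function.support (fun s => dualNorm N s) = {0}ᶜ := by
    ext s
    simp only [Function.mem_support, Set.mem_compl_iff, Set.mem_singleton_iff, not_iff_not]
    exact ⟨dualSeminorm_eq_zero hN s, fun h => by
      rw [h, ← dualSeminorm_apply hN, map_zero]⟩
  have h0 : P {0} = 0 := hP (measure_singleton 0)
  rw [hsupp, pos_iff_ne_zero]
  intro hc
  have hu := measure_union_le (μ := P) {0} ({0}ᶜ : Set (Vec d))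
  rw [Set.union_compl_self, h0, hc, add_zero, nonpos_iff_eq_zero,
    Measure.measure_univ_eq_zero] at hu
  exact NeZero.ne P hu

/-- Regret of the deterministic predictions against linear losses `v t` with guesses `u t`, for every
sequence: the increments of the potential telescope. -/
theorem sum_inner_gradPhi_sub_le (hN : ∀ v, N v = 0 → v = 0) (hP : P ≪ volume) (hX : IsCompact X)
    (hPint : Integrable (fun s => dualNorm N s) P) {β : ℝ} (hβ : 0 < β)
    (hstable : IsStable X P (dualNorm N) β) (v u : ℕ → Vec d) (T : ℕ) {y : Vec d} (hy : y ∈ X) :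
    ∑ t ∈ Finset.range T,
        inner ℝ (v t) (gradPhi X P (∑ s ∈ Finset.range t, v s + u t) - y) ≤
      (∫ s, dualNorm N s ∂P) * diameter N X
      + ∑ t ∈ Finset.range T, (β / 2 * dualNorm N (v t - u t) ^ 2
        - 1 / (2 * β) * N (gradPhi X P (∑ s ∈ Finset.range t, v s + u t)
          - gradPhi X P (∑ s ∈ Finset.range t, v s)) ^ 2) := by
  have hne : X.Nonempty := ⟨y, hy⟩
  have hs := integrable_id_of_dualNorm hN hPint
  have hsup := potential_le_add_inner (P := P) hP hX hne hs
  have hlip : ∀ a b, N (gradPhi X P a - gradPhi X P b) ≤ β * dualNorm N (a - b) := fun a b =>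
    (le_dualNorm_dualNorm hN _).trans (hstable a b)
  have hstep := fun t => optimistic_step hN hsup hlip hβ (∑ s ∈ Finset.range t, v s) (u t) (v t)
  have htel := Finset.sum_range_sub (fun t => potential X P (∑ s ∈ Finset.range t, v s)) T
  have hlast := potential_sub_le hN hX hs hPint (∑ s ∈ Finset.range T, v s) hy
  rw [sum_inner] at hlast
  simp only [Finset.sum_range_zero] at htel
  rw [← htel] at hlast
  have hsum := Finset.sum_le_sum fun t (_ : t ∈ Finset.range T) => hstep t
  simp only [← Finset.sum_range_succ v, inner_sub_right, Finset.sum_sub_distrib,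
    Finset.sum_add_distrib, real_inner_comm (v _) (gradPhi X P _)] at hsum hlast ⊢
  simp only [real_inner_comm (gradPhi X P _) (v _)] at hsum ⊢
  linarith

end Deterministic

/-! ### The run of the algorithm -/

section Run

variable {d m T : ℕ} {X : Set (Vec d)} {P : Measure (Vec d)}
  {Ω : Type*} {mΩ : MeasurableSpace Ω} {μ : Measure Ω} {ℱ : Filtration ℕ mΩ}
  {f : ℕ → Ω → Vec d → ℝ} {gradf : ℕ → Ω → Vec d → Vec d} {g : ℕ → Ω → Vec d}
  {σ x : ℕ → Fin m → Ω → Vec d}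

theorem IsRun.isFreshDraw (h : IsRun μ ℱ X P T f gradf g σ x) {t : ℕ} (ht : t < T) :
    IsFreshDraw (ℱ t) μ P (σ t) where
  le := ℱ.le t
  measurable j := (h.measurable_pert t ht j).mono (ℱ.le _) le_rfl
  law := h.law_pert t ht
  indep := h.indep_pert t ht
  indep_past := h.indep_past t ht

theorem IsRun.average_mem (h : IsRun μ ℱ X P T f gradf g σ x) (hXc : Convex ℝ X) (hm : 0 < m)
    {t : ℕ} (ht : t < T) (ω : Ω) : average (x t) ω ∈ X :=
  OFTPL.average_mem hXc hm fun j => (h.pred_mem t ht j ω).1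

theorem IsRun.measurable_average (h : IsRun μ ℱ X P T f gradf g σ x) {t : ℕ} (ht : t < T) :
    Measurable[ℱ (t + 1)] (average (x t)) :=
  @OFTPL.measurable_average _ _ _ (ℱ (t + 1)) _ (h.measurable_pred t ht)

theorem IsRun.measurable_playedGrad (h : IsRun μ ℱ X P T f gradf g σ x) (hXc : Convex ℝ X)
    (hm : 0 < m) {t : ℕ} (ht : t < T) : Measurable[ℱ (t + 1)] (playedGrad gradf x t) := by
  have hgr : Measurable[(ℱ (t + 1)).prod inferInstance] (fun p : Ω × X => gradf t p.1 p.2) :=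
    (h.measurable_grad t ht).mono
      (sup_le_sup (MeasurableSpace.comap_mono (ℱ.mono (Nat.le_succ t))) le_rfl) le_rfl
  exact measurable_gradient_comp hgr (h.measurable_average ht) (h.average_mem hXc hm ht)

theorem IsRun.pastInfo_le (h : IsRun μ ℱ X P T f gradf g σ x) (hXc : Convex ℝ X) (hm : 0 < m)
    {t : ℕ} (ht : t < T) : pastInfo X f gradf x t ≤ ℱ t := by
  refine iSup_le fun s => ?_
  have hs : (s : ℕ) < T := s.2.trans ht
  have h0 : ℱ s ≤ ℱ t := ℱ.mono s.2.le
  have h1 : ℱ (s + 1) ≤ ℱ t := ℱ.mono s.2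
  refine sup_le (sup_le (iSup_le fun y => ?_) (iSup_le fun y => ?_)) (sup_le ?_ ?_)
  · exact (h.measurable_loss s hs y y.2).comap_le.trans h0
  · have := measurable_gradient_comp (h.measurable_grad s hs)
      (w := fun _ => (y : Vec d)) (@measurable_const _ _ _ (ℱ s) _) fun _ => y.2
    exact this.comap_le.trans h0
  · exact (h.measurable_average hs).comap_le.trans h1
  · exact (h.measurable_playedGrad hXc hm hs).comap_le.trans h1

theorem measurable_pastGradSum (t : ℕ) :
    Measurable[pastInfo X f gradf x t] (pastGradSum gradf x t) := by
  refine @Finset.measurable_fun_sum _ _ _ _ _ _ (pastInfo X f gradf x t) _ _ fun s hs => ?_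
  refine Measurable.of_comap_le ?_
  exact (le_sup_right.trans le_sup_right).trans
    (le_iSup (fun s : Fin t =>
    ((⨆ y : X, MeasurableSpace.comap (fun ω => f s ω y) inferInstance) ⊔
      (⨆ y : X, MeasurableSpace.comap (fun ω => gradf s ω y) inferInstance)) ⊔
    (MeasurableSpace.comap (average (x s)) inferInstance ⊔
      MeasurableSpace.comap (playedGrad gradf x s) inferInstance)) ⟨s, Finset.mem_range.mp hs⟩)

variable [IsProbabilityMeasure P] [IsProbabilityMeasure μ]

/-- The deterministic prediction of a round is `∇Φ` at the past gradients plus the guess. -/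
theorem IsRun.condPred_ae_eq (h : IsRun μ ℱ X P T f gradf g σ x) (hP : P ≪ volume)
    (hX : IsCompact X) (hXc : Convex ℝ X) (hne : X.Nonempty) (hm : 0 < m) {t : ℕ} (ht : t < T) :
    condPred μ X f gradf g x t =ᵐ[μ]
      fun ω => gradPhi X P (pastGradSum gradf x t ω + g t ω) := by
  have hle : MeasurableSpace.comap (g t) inferInstance ⊔ pastInfo X f gradf x t ≤ ℱ t :=
    sup_le (h.measurable_guess t ht).comap_le (h.pastInfo_le hXc hm ht)
  have hmeas : Measurable[MeasurableSpace.comap (g t) inferInstance ⊔ pastInfo X f gradf x t]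
      fun ω => pastGradSum gradf x t ω + g t ω :=
    ((measurable_pastGradSum t).mono le_sup_right le_rfl).add
      (Measurable.of_comap_le le_sup_left)
  exact (h.isFreshDraw ht).condExp_average hP hX hXc hne hm hle hmeas
    (fun j => (h.measurable_pred t ht j).mono (ℱ.le _) le_rfl) (h.pred_mem t ht)

/-- With guess zero, the deterministic prediction is `∇Φ` at the past gradients. -/
theorem IsRun.condPredZero_ae_eq (h : IsRun μ ℱ X P T f gradf g σ x) (hP : P ≪ volume)
    (hX : IsCompact X) (hXc : Convex ℝ X) (hne : X.Nonempty) (hm : 0 < m) {t : ℕ} (ht : t < T)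
    {xz : ℕ → Fin m → Ω → Vec d} (hxzmeas : ∀ j, Measurable (xz t j))
    (hxz : ∀ j ω, xz t j ω ∈ linArgmin X (pastGradSum gradf x t ω - σ t j ω)) :
    condPredZero μ X f gradf x xz t =ᵐ[μ] fun ω => gradPhi X P (pastGradSum gradf x t ω) :=
  (h.isFreshDraw ht).condExp_average hP hX hXc hne hm (h.pastInfo_le hXc hm ht)
    (measurable_pastGradSum t) hxzmeas hxz

end Run

end OFTPL

/-! ### The regret bound -/

theorem mainTheorem3 {d : ℕ} (hd : 0 < d)
    -- the norm, the action set, and the perturbation distribution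
    (N : Seminorm ℝ (OFTPL.Vec d)) (hN : ∀ v, N v = 0 → v = 0)
    (X : Set (OFTPL.Vec d)) (hXcompact : IsCompact X) (hXconvex : Convex ℝ X)
    (P : Measure (OFTPL.Vec d)) [IsProbabilityMeasure P] (hP : P ≪ volume)
    (hPint : Integrable (fun s => OFTPL.dualNorm N s) P)
    (η : ℝ) (hη : η = ∫ s, OFTPL.dualNorm N s ∂P)
    (C : ℝ) (hC : 0 < C) (hstable : OFTPL.IsStable X P (OFTPL.dualNorm N) (C * η⁻¹))
    -- a run of the algorithm
    {m : ℕ} (hm : 0 < m) (T : ℕ)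
    {Ω : Type*} [mΩ : MeasurableSpace Ω] (μ : Measure Ω) [IsProbabilityMeasure μ]
    (ℱ : Filtration ℕ mΩ)
    (f : ℕ → Ω → OFTPL.Vec d → ℝ) (gradf : ℕ → Ω → OFTPL.Vec d → OFTPL.Vec d)
    (g : ℕ → Ω → OFTPL.Vec d) (σ x : ℕ → Fin m → Ω → OFTPL.Vec d)
    (hrun : OFTPL.IsRun μ ℱ X P T f gradf g σ x)
    -- the losses are convex and differentiable on `X`, with Hölder continuous gradients
    (hconv : ∀ t < T, ∀ ω, ConvexOn ℝ X (f t ω))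
    (hgrad : ∀ t < T, ∀ ω, ∀ y ∈ X, HasGradientWithinAt (f t ω) (gradf t ω y) X y)
    (L α : ℝ) (hα : α ∈ Set.Icc (0 : ℝ) 1)
    (hholder : ∀ t < T, ∀ ω, ∀ y₁ ∈ X, ∀ y₂ ∈ X,
      OFTPL.dualNorm N (gradf t ω y₁ - gradf t ω y₂) ≤ L * N (y₁ - y₂) ^ α)
    -- finite expectations
    (hfint : ∀ t < T, ∀ y ∈ X, Integrable (fun ω => f t ω y) μ)
    (hgint : ∀ t < T, Integrable
      (fun ω => OFTPL.dualNorm N (OFTPL.playedGrad gradf x t ω - g t ω) ^ 2) μ)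
    -- the minimizers that round `t` would produce with guess `0`
    (xz : ℕ → Fin m → Ω → OFTPL.Vec d) (hxzmeas : ∀ t < T, ∀ j, Measurable (xz t j))
    (hxz : ∀ t < T, ∀ j ω,
      xz t j ω ∈ OFTPL.linArgmin X (OFTPL.pastGradSum gradf x t ω - σ t j ω)) :
    (∀ t < T, Integrable (fun ω => N (OFTPL.condPred μ X f gradf g x t ω -
        OFTPL.condPredZero μ X f gradf x xz t ω) ^ 2) μ) ∧
    ∀ y ∈ X,
      Integrable
        (fun ω => ∑ t ∈ Finset.range T, (f t ω (OFTPL.average (x t) ω) - f t ω y)) μ ∧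
      ∫ ω, ∑ t ∈ Finset.range T, (f t ω (OFTPL.average (x t) ω) - f t ω y) ∂μ ≤
        η * OFTPL.diameter N X
        + ∑ t ∈ Finset.range T, C / (2 * η) *
            ∫ ω, OFTPL.dualNorm N (OFTPL.playedGrad gradf x t ω - g t ω) ^ 2 ∂μ
        - ∑ t ∈ Finset.range T, η / (2 * C) *
            ∫ ω, N (OFTPL.condPred μ X f gradf g x t ω -
              OFTPL.condPredZero μ X f gradf x xz t ω) ^ 2 ∂μ
        + L * T * (OFTPL.compatOne N * OFTPL.compatTwo N * OFTPL.diameter N X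
            / Real.sqrt m) ^ (1 + α) := by
  have hη0 : 0 < η := hη ▸ OFTPL.integral_dualNorm_pos hd hN hP hPint
  -- A negative Hölder constant forces `X` to be a single point, so that it may be replaced by `0`.
  obtain ⟨L', hL', hholder', hLL⟩ : ∃ L' : ℝ, 0 ≤ L' ∧
      (∀ t < T, ∀ ω, ∀ y₁ ∈ X, ∀ y₂ ∈ X,
        OFTPL.dualNorm N (gradf t ω y₁ - gradf t ω y₂) ≤ L' * N (y₁ - y₂) ^ α) ∧
      L' * T * (OFTPL.compatOne N * OFTPL.compatTwo N * OFTPL.diameter N X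
            / Real.sqrt m) ^ (1 + α) ≤
        L * T * (OFTPL.compatOne N * OFTPL.compatTwo N * OFTPL.diameter N X
            / Real.sqrt m) ^ (1 + α) := by
    rcases le_or_gt 0 L with hL | hL
    · exact ⟨L, hL, hholder, le_rfl⟩
    refine ⟨0, le_rfl, fun t ht ω y₁ h₁ y₂ h₂ => (hholder t ht ω y₁ h₁ y₂ h₂).trans ?_, ?_⟩
    · rw [zero_mul]
      exact mul_nonpos_of_nonpos_of_nonneg hL.le (Real.rpow_nonneg (apply_nonneg N _) _)
    · rcases Nat.eq_zero_or_pos T with rfl | hT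
      · simp
      have hsub : X.Subsingleton := fun y₁ h₁ y₂ h₂ => by
        by_contra hne
        obtain ⟨ω⟩ : Nonempty Ω := nonempty_of_isProbabilityMeasure μ
        have hpos : 0 < N (y₁ - y₂) :=
          lt_of_le_of_ne (apply_nonneg N _) fun h => hne (sub_eq_zero.mp (hN _ h.symm))
        have h1 := hholder 0 hT ω y₁ h₁ y₂ h₂
        have h2 := mul_neg_of_neg_of_pos hL (Real.rpow_pos_of_pos hpos α)
        exact absurd (OFTPL.dualNorm_nonneg hN (gradf 0 ω y₁ - gradf 0 ω y₂)) (by linarith)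
      have hα1 : 1 + α ≠ 0 := by linarith [hα.1]
      simp [OFTPL.diameter_eq_zero_of_subsingleton hsub, Real.zero_rpow hα1]
  set β := C * η⁻¹ with hβ
  have hβ0 : 0 < β := mul_pos hC (inv_pos.mpr hη0)
  have hβ1 : C / (2 * η) = β / 2 := by rw [hβ]; field_simp
  have hβ2 : η / (2 * C) = 1 / (2 * β) := by rw [hβ]; field_simp
  rw [hβ1, hβ2]
  -- measurable versions of the deterministic predictions with the guess `g t` and with guess `0`
  let a : ℕ → Ω → OFTPL.Vec d := fun t ω =>
    OFTPL.gradPhi X P (OFTPL.pastGradSum gradf x t ω + g t ω)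
  let b : ℕ → Ω → OFTPL.Vec d := fun t ω => OFTPL.gradPhi X P (OFTPL.pastGradSum gradf x t ω)
  have hne : ∀ t < T, X.Nonempty := fun t ht => by
    obtain ⟨ω⟩ : Nonempty Ω := nonempty_of_isProbabilityMeasure μ
    exact ⟨_, hrun.average_mem hXconvex hm ht ω⟩
  have hpast : ∀ t < T, Measurable[ℱ t] (OFTPL.pastGradSum gradf x t) := fun t ht =>
    (OFTPL.measurable_pastGradSum (X := X) (f := f) t).mono (hrun.pastInfo_le hXconvex hm ht) le_rfl
  have hH : ∀ t < T, Measurable[ℱ t] fun ω => OFTPL.pastGradSum gradf x t ω + g t ω :=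
    fun t ht => (hpast t ht).add (hrun.measurable_guess t ht)
  have ham : ∀ t < T, Measurable (a t) := fun t ht =>
    (OFTPL.measurable_gradPhi hP hXcompact (hne t ht)).comp ((hH t ht).mono (ℱ.le t) le_rfl)
  have hbm : ∀ t < T, Measurable (b t) := fun t ht =>
    (OFTPL.measurable_gradPhi hP hXcompact (hne t ht)).comp ((hpast t ht).mono (ℱ.le t) le_rfl)
  have habi : ∀ t < T, Integrable (fun ω => N (a t ω - b t ω) ^ 2) μ := fun t ht => by
    refine Integrable.of_bound ((OFTPL.measurable_seminorm.comp
      ((ham t ht).sub (hbm t ht))).pow_const 2).aestronglyMeasurable (OFTPL.diameter N X ^ 2)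
      (Filter.Eventually.of_forall fun ω => ?_)
    rw [Real.norm_of_nonneg (sq_nonneg _)]
    exact pow_le_pow_left₀ (apply_nonneg N _) (OFTPL.le_diameter hXcompact
      (OFTPL.gradPhi_mem hP hXcompact hXconvex (hne t ht) _)
      (OFTPL.gradPhi_mem hP hXcompact hXconvex (hne t ht) _)) 2
  have hab : ∀ t < T, (fun ω => N (OFTPL.condPred μ X f gradf g x t ω -
      OFTPL.condPredZero μ X f gradf x xz t ω) ^ 2) =ᵐ[μ] fun ω => N (a t ω - b t ω) ^ 2 :=
    fun t ht => by
      filter_upwards [hrun.condPred_ae_eq hP hXcompact hXconvex (hne t ht) hm ht,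
        hrun.condPredZero_ae_eq hP hXcompact hXconvex (hne t ht) hm ht (hxzmeas t ht) (hxz t ht)]
        with ω h1 h2
      rw [h1, h2]
  refine ⟨fun t ht => (habi t ht).congr (hab t ht).symm, fun y hy => ?_⟩
  have hregi : ∀ t ∈ Finset.range T,
      Integrable (fun ω => f t ω (OFTPL.average (x t) ω) - f t ω y) μ := fun t ht' => by
    have ht := Finset.mem_range.mp ht'
    exact OFTPL.integrable_loss_sub hN hXcompact hL' hα.1 (hconv t ht) (hgrad t ht)
      (hholder' t ht) (fun z hz => (hrun.measurable_loss t ht z hz).mono (ℱ.le t) le_rfl)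
      (hfint t ht) ((hrun.measurable_average ht).mono (ℱ.le _) le_rfl)
      (hrun.average_mem hXconvex hm ht) hy
  refine ⟨integrable_finsetSum _ hregi, ?_⟩
  have hsample := fun t (ht : t < T) => (hrun.isFreshDraw ht).integral_inner_gradient_le hN hP
    hXcompact hXconvex (hne t ht) hm (hH t ht)
    (fun j => (hrun.measurable_pred t ht j).mono (ℱ.le _) le_rfl) (hrun.pred_mem t ht) hL' hα
    (hconv t ht) (hgrad t ht) (hholder' t ht) (hrun.measurable_grad t ht) (hfint t ht)
  -- the bound that holds for every outcome, before expectations are taken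
  have hpath : ∀ ω, ∑ t ∈ Finset.range T, (f t ω (OFTPL.average (x t) ω) - f t ω y) ≤
      (η * OFTPL.diameter N X + ∑ t ∈ Finset.range T,
        (β / 2 * OFTPL.dualNorm N (OFTPL.playedGrad gradf x t ω - g t ω) ^ 2
          - 1 / (2 * β) * N (a t ω - b t ω) ^ 2))
      + ∑ t ∈ Finset.range T,
        inner ℝ (OFTPL.playedGrad gradf x t ω) (OFTPL.average (x t) ω - a t ω) := fun ω => by
    have h1 := OFTPL.sum_inner_gradPhi_sub_le hN hP hXcompact hPint hβ0 hstable
      (fun t => OFTPL.playedGrad gradf x t ω) (fun t => g t ω) T hy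
    rw [← hη] at h1
    have h2 : ∑ t ∈ Finset.range T, (f t ω (OFTPL.average (x t) ω) - f t ω y) ≤
        ∑ t ∈ Finset.range T, (inner ℝ (OFTPL.playedGrad gradf x t ω) (a t ω - y)
          + inner ℝ (OFTPL.playedGrad gradf x t ω) (OFTPL.average (x t) ω - a t ω)) := by
      refine Finset.sum_le_sum fun t ht' => ?_
      have ht := Finset.mem_range.mp ht'
      have hav := hrun.average_mem hXconvex hm ht ω
      have h3 := OFTPL.inner_gradient_le_sub (hconv t ht ω) (hgrad t ht ω _ hav) hav hy
      rw [← inner_add_right, add_comm, sub_add_sub_cancel]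
      rw [← neg_sub (OFTPL.average (x t) ω) y, inner_neg_right] at h3
      rw [OFTPL.playedGrad]
      linarith
    rw [Finset.sum_add_distrib] at h2
    exact h2.trans (add_le_add h1 le_rfl)
  have hquad : ∀ t ∈ Finset.range T, Integrable (fun ω =>
      β / 2 * OFTPL.dualNorm N (OFTPL.playedGrad gradf x t ω - g t ω) ^ 2
          - 1 / (2 * β) * N (a t ω - b t ω) ^ 2) μ := fun t ht' =>
    ((hgint t (Finset.mem_range.mp ht')).const_mul _).sub
      ((habi t (Finset.mem_range.mp ht')).const_mul _)
  have hdev : ∀ t ∈ Finset.range T, Integrable (fun ω =>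
      inner ℝ (OFTPL.playedGrad gradf x t ω) (OFTPL.average (x t) ω - a t ω)) μ := fun t ht' =>
    (hsample t (Finset.mem_range.mp ht')).1
  have hmain := integral_mono (integrable_finsetSum _ hregi)
    (((integrable_const _).add (integrable_finsetSum _ hquad)).add (integrable_finsetSum _ hdev))
    hpath
  refine hmain.trans ?_
  rw [integral_add' ((integrable_const _).add (integrable_finsetSum _ hquad))
    (integrable_finsetSum _ hdev), integral_add' (integrable_const _)
    (integrable_finsetSum _ hquad), integral_finsetSum _ hquad, integral_finsetSum _ hdev,
    integral_const, probReal_univ, one_smul]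
  have h4 : ∑ t ∈ Finset.range T, ∫ ω,
        (β / 2 * OFTPL.dualNorm N (OFTPL.playedGrad gradf x t ω - g t ω) ^ 2
          - 1 / (2 * β) * N (a t ω - b t ω) ^ 2) ∂μ
      = ∑ t ∈ Finset.range T, β / 2 *
            ∫ ω, OFTPL.dualNorm N (OFTPL.playedGrad gradf x t ω - g t ω) ^ 2 ∂μ
        - ∑ t ∈ Finset.range T, 1 / (2 * β) *
            ∫ ω, N (OFTPL.condPred μ X f gradf g x t ω -
              OFTPL.condPredZero μ X f gradf x xz t ω) ^ 2 ∂μ := by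
    rw [← Finset.sum_sub_distrib]
    refine Finset.sum_congr rfl fun t ht' => ?_
    have ht := Finset.mem_range.mp ht'
    rw [integral_sub ((hgint t ht).const_mul _) ((habi t ht).const_mul _), integral_const_mul,
      integral_const_mul, integral_congr_ae (hab t ht)]
  have h5 := Finset.sum_le_sum fun t (ht : t ∈ Finset.range T) =>
    (hsample t (Finset.mem_range.mp ht)).2
  rw [Finset.sum_const, Finset.card_range, nsmul_eq_mul, ← mul_assoc, mul_comm (T : ℝ) L'] at h5
  rw [h4, add_sub_assoc]
  exact add_le_add le_rfl (h5.trans hLL)
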